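/- Let $M$ be a finite-dimensional (Hausdorff) complex manifold with complex structure $I$, and let $\omega$ be a Kähler form on $M$, normalized so that the Kähler metric is $g(u,v)=\omega(Iu,v)$. Let $L\to M$ be a smooth Hermitian line bundle with a Hermitian connection $\nabla$ whose curvature form is $F_\nabla=2\pi i\,\omega$; the connection induces a holomorphic structure on $L$, for which a smooth section is holomorphic iff the $(0,1)$-part of its covariant derivative vanishes. Let $s$ be a holomorphic section of $L$, with zero set $D_s=\{s=0\}$. On $M\setminus D_s$ put $$\rho_s=\frac{\langle\nabla s,s\rangle}{\langle s,s\rangle},\qquad \phi_s=-\frac1{2\pi}\ln|s| ,$$ and for a real $1$-form $\alpha$ let $(I\alpha)(v)=\alpha(Iv)$. Then: 1. On $M\setminus D_s$ the calibrating form is $\operatorname{Im}\rho_s=-I\,(d\ln|s|)$. 2. $M\setminus D_s$ is open, $\phi_s$ is smooth there, $d(I\,d\phi_s)=\omega$, and $\phi_s$ is strictly plurisubharmonic on $M\setminus D_s$ (its Levi form is positive definite in every holomorphic chart). 3. Let $S\subset M$ be an embedded Lagrangian submanifold. Call $S$ special Bohr–Sommerfeld with respect to $s$ if $(L,\nabla)|_S$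 admits a nowhere vanishing covariantly constant section $\sigma_S$, $s$ has no zeros on $S$, and $s|_S=f e^{ic}\sigma_S$ with a real constant $c$ and a positive real function $f$ on $S$. Then $S$ is special Bohr–Sommerfeld with respect to $s$ if and only if $S\cap D_s=\emptyset$ and $\operatorname{grad}\phi_s(p)\in T_pS$ for every $p\in S$, the gradient being taken for the metric $g$. 4. If moreover $S$ is compact, then $S$ is special Bohr–Sommerfeld with respect to $s$ if and only if $S\cap D_s=\emptyset$ and $S$ is preserved by the gradient flow of $\phi_s$, i.e. every integral curve of $\operatorname{grad}\phi_s$ in $M\setminus D_s$, defined on an open interval, that meets $S$ is contained in $S$. -/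

import Mathlib

open Set Bundle
open scoped Manifold ContDiff Topology

noncomputable section

namespace SBS

/-! ### Complex manifolds and complex bundles as real ones

`M` is a complex manifold modelled on a complex normed space `E`. The same charts make it a real
smooth manifold with model `𝓘(ℝ, E)`, and a complex vector bundle is in particular a real one. -/

section RealStructure

variable {E : Type*} [NormedAddCommGroup E] [NormedSpace ℂ E]
  {M : Type*} [TopologicalSpace M] [ChartedSpace E M]

/-- A complex manifold is a real smooth manifold with the same charts. -/
instance isManifold_real [IsManifold 𝓘(ℂ, E) ω M] : IsManifold 𝓘(ℝ, E) ∞ M := by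
  refine isManifold_of_contDiffOn _ _ _ fun e e' he he' => ?_
  have h := ((contDiffGroupoid ω 𝓘(ℂ, E)).compatible (H := E) (M := M) he he').1
  have h' : ContDiffOn ℂ ω (𝓘(ℂ, E) ∘ (e.symm ≫ₕ e') ∘ 𝓘(ℂ, E).symm)
      (𝓘(ℂ, E).symm ⁻¹' (e.symm ≫ₕ e').source ∩ range 𝓘(ℂ, E)) := h
  exact (h'.restrict_scalars ℝ).of_le le_top

/-- The underlying real vector bundle of a complex vector bundle. -/
instance vectorBundle_real {F : Type*} [NormedAddCommGroup F] [NormedSpace ℂ F]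
    {L : M → Type*} [∀ x, NormedAddCommGroup (L x)] [∀ x, InnerProductSpace ℂ (L x)]
    [TopologicalSpace (TotalSpace F L)] [FiberBundle F L] [h : VectorBundle ℂ F L] :
    VectorBundle ℝ F L := by
  have lin : ∀ (e : Trivialization F (TotalSpace.proj : TotalSpace F L → M))
      [MemTrivializationAtlas e], e.IsLinear ℝ := fun e _ =>
    { linear := fun b hb =>
        { map_add := (Trivialization.linear ℂ e hb).map_add
          map_smul := fun c v => by
            have := (Trivialization.linear ℂ e hb).map_smul (c : ℂ) v
            simpa only [Complex.coe_smul] using this } }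
  refine { trivialization_linear' := fun e _ => lin e, continuousOn_coordChange' := ?_ }
  intro e e' _ _
  have := lin e
  have := lin e'
  have hc := (ContinuousLinearMap.restrictScalarsL ℂ F F ℝ ℝ).continuous.comp_continuousOn
    (continuousOn_coordChange ℂ e e')
  refine hc.congr fun b hb => ?_
  ext y
  simp [Trivialization.coordChangeL_apply _ _ hb]

end RealStructure

variable {E : Type*} [NormedAddCommGroup E] [NormedSpace ℂ E]
  {M : Type*} [TopologicalSpace M] [ChartedSpace E M]

/-! ### The complex structure and differential forms -/

/-- The complex structure `I` on the real tangent space `T_x M`, i.e. multiplication by `i` in the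
holomorphic chart at `x`. -/
def complexStructure (x : M) : TangentSpace 𝓘(ℝ, E) x →L[ℝ] TangentSpace 𝓘(ℝ, E) x :=
  (Complex.I • ContinuousLinearMap.id ℝ E : E →L[ℝ] E)

/-- A real differential `k`-form on `M` (no regularity imposed). -/
abbrev Form (E : Type*) [NormedAddCommGroup E] [NormedSpace ℂ E]
    (M : Type*) [TopologicalSpace M] [ChartedSpace E M] (k : ℕ) : Type _ :=
  Π x : M, TangentSpace 𝓘(ℝ, E) x [⋀^Fin k]→L[ℝ] ℝ

/-- The `1`-form with values `α x`, as an alternating form of degree one. -/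
def oneForm (α : Π x : M, TangentSpace 𝓘(ℝ, E) x →L[ℝ] ℝ) : Form E M 1 := fun x =>
  ContinuousAlternatingMap.ofSubsingleton ℝ (TangentSpace 𝓘(ℝ, E) x) ℝ (0 : Fin 1) (α x)

/-- The `1`-form `I α`, given by `(I α)(v) = α (I v)`. -/
def complexStructureForm (α : Π x : M, TangentSpace 𝓘(ℝ, E) x →L[ℝ] ℝ) (x : M) :
    TangentSpace 𝓘(ℝ, E) x →L[ℝ] ℝ :=
  α x ∘L complexStructure x

/-- The form `α` written in the chart at `x₀`: its pull-back under the inverse of the chart. -/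
def Form.inChart {k : ℕ} (α : Form E M k) (x₀ : M) (y : E) : E [⋀^Fin k]→L[ℝ] ℝ :=
  (α ((extChartAt 𝓘(ℝ, E) x₀).symm y)).compContinuousLinearMap
    (mfderiv 𝓘(ℝ, E) 𝓘(ℝ, E) (extChartAt 𝓘(ℝ, E) x₀).symm y)

/-- A form is smooth if it is smooth in all charts. -/
def Form.IsSmooth {k : ℕ} (α : Form E M k) : Prop :=
  ∀ x₀ : M, ContDiffOn ℝ ∞ (α.inChart x₀) (extChartAt 𝓘(ℝ, E) x₀).target

/-- The exterior derivative of a form on `M`, computed at `x` in the chart at `x`. -/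
def Form.d {k : ℕ} (α : Form E M k) : Form E M (k + 1) := fun x =>
  (extDeriv (α.inChart x) (extChartAt 𝓘(ℝ, E) x x)).compContinuousLinearMap
    (mfderiv 𝓘(ℝ, E) 𝓘(ℝ, E) (extChartAt 𝓘(ℝ, E) x) x)

/-- `Ω` is a Kähler form on the complex manifold `M`: a smooth closed real `2`-form (nondegenerate
by the last condition) that is compatible with `I`, the Riemannian metric being
`g(u, v) = Ω(I u, v)`. -/
structure IsKahlerForm (Ω : Form E M 2) : Prop where
  smooth : Ω.IsSmooth
  closed : ∀ x, Ω.d x = 0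
  invariant : ∀ x (u v : TangentSpace 𝓘(ℝ, E) x),
    Ω x ![complexStructure x u, complexStructure x v] = Ω x ![u, v]
  pos : ∀ x (u : TangentSpace 𝓘(ℝ, E) x), u ≠ 0 → 0 < Ω x ![complexStructure x u, u]

/-- The Kähler metric `g(u, v) = Ω(I u, v)`. -/
def kahlerMetric (Ω : Form E M 2) (x : M) (u v : TangentSpace 𝓘(ℝ, E) x) : ℝ :=
  Ω x ![complexStructure x u, v]

open Classical in
/-- The gradient of `f` for the Kähler metric: `g(grad f, v) = df(v)` for all `v`. -/
def gradient (Ω : Form E M 2) (f : M → ℝ) (x : M) : TangentSpace 𝓘(ℝ, E) x :=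
  if h : ∃ w : TangentSpace 𝓘(ℝ, E) x, ∀ v, kahlerMetric Ω x w v = mvfderiv 𝓘(ℝ, E) f x v
  then h.choose else 0

/-- For a Kähler form the gradient exists, so its defining property always holds. -/
theorem kahlerMetric_gradient [FiniteDimensional ℂ E] {Ω : Form E M 2} (hΩ : IsKahlerForm Ω)
    (f : M → ℝ) (x : M) (v : TangentSpace 𝓘(ℝ, E) x) :
    kahlerMetric Ω x (gradient Ω f x) v = mvfderiv 𝓘(ℝ, E) f x v := by
  suffices h : ∃ w : TangentSpace 𝓘(ℝ, E) x, ∀ v,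
      kahlerMetric Ω x w v = mvfderiv 𝓘(ℝ, E) f x v by
    rw [gradient, dif_pos h]
    exact h.choose_spec v
  have hfd : FiniteDimensional ℝ E := FiniteDimensional.complexToReal E
  have : FiniteDimensional ℝ (TangentSpace 𝓘(ℝ, E) x) := hfd
  have e0 (a b : TangentSpace 𝓘(ℝ, E) x) : ![a, b] = Function.update ![0, b] 0 a := by
    ext i; fin_cases i <;> rfl
  have e1 (a b : TangentSpace 𝓘(ℝ, E) x) : ![a, b] = Function.update ![a, 0] 1 b := by
    ext i; fin_cases i <;> rfl
  let B : TangentSpace 𝓘(ℝ, E) x →ₗ[ℝ] Module.Dual ℝ (TangentSpace 𝓘(ℝ, E) x) :=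
    LinearMap.mk₂ ℝ (fun u v => Ω x ![complexStructure x u, v])
      (fun u u' v => by
        rw [map_add, e0 (complexStructure x u + complexStructure x u') v, e0 (complexStructure x u) v,
          e0 (complexStructure x u') v]
        exact (Ω x).map_update_add ![0, v] 0 (complexStructure x u) (complexStructure x u'))
      (fun c u v => by
        rw [map_smul, e0 (c • complexStructure x u) v, e0 (complexStructure x u) v]
        exact (Ω x).map_update_smul ![0, v] 0 c (complexStructure x u))
      (fun u v v' => by
        rw [e1 _ (v + v'), e1 _ v, e1 _ v']
        exact (Ω x).map_update_add ![complexStructure x u, 0] 1 v v')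
      (fun c u v => by
        rw [e1 _ (c • v), e1 _ v]
        exact (Ω x).map_update_smul ![complexStructure x u, 0] 1 c v)
  have hB : Function.Injective B := by
    rw [injective_iff_map_eq_zero]
    intro u hu
    by_contra hne
    have h0 : Ω x ![complexStructure x u, u] = 0 := congrArg (fun l => l u) hu
    exact (hΩ.pos x u hne).ne' h0
  have hs : Function.Surjective B :=
    (LinearMap.injective_iff_surjective_of_finrank_eq_finrank
      (Subspace.dual_finrank_eq).symm).1 hB
  obtain ⟨w, hw⟩ := hs (mvfderiv 𝓘(ℝ, E) f x : TangentSpace 𝓘(ℝ, E) x →ₗ[ℝ] ℝ)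
  exact ⟨w, fun v => congrArg (fun l => l v) hw⟩

/-! ### Plurisubharmonic functions -/

/-- The Levi form `∑ ∂²f/∂z_j∂z̄_k v_j v̄_k` of a `C²` function `f` on a complex vector space, at the
point `y` and in the direction `v`. -/
def leviForm (f : E → ℝ) (y v : E) : ℝ :=
  (fderiv ℝ (fderiv ℝ f) y v v + fderiv ℝ (fderiv ℝ f) y (Complex.I • v) (Complex.I • v)) / 4

/-- `f` is a `C²` strictly plurisubharmonic function on the open set `U`: in every holomorphic chart
its Levi form is positive definite at all points of `U`. -/
def IsStrictlyPlurisubharmonicOn (E : Type*) [NormedAddCommGroup E] [NormedSpace ℂ E]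
    [ChartedSpace E M] (f : M → ℝ) (U : Set M) : Prop :=
  ContMDiffOn 𝓘(ℝ, E) 𝓘(ℝ) 2 f U ∧
    ∀ e ∈ IsManifold.maximalAtlas 𝓘(ℂ, E) ω M, ∀ x ∈ e.source ∩ U, ∀ v : E, v ≠ 0 →
      0 < leviForm (f ∘ e.symm) (e x) v

/-! ### Prequantization -/

section Bundle

variable {L : M → Type*} [∀ x, NormedAddCommGroup (L x)] [∀ x, InnerProductSpace ℂ (L x)]
  [TopologicalSpace (TotalSpace ℂ L)] [FiberBundle ℂ L]

/-- A section of `L` that is smooth at `x`. -/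
def SmoothSectionAt (E : Type*) [NormedAddCommGroup E] [NormedSpace ℂ E]
    [ChartedSpace E M] (σ : Π x : M, L x) (x : M) : Prop :=
  ContMDiffAt 𝓘(ℝ, E) (𝓘(ℝ, E).prod 𝓘(ℝ, ℂ)) ∞ (fun y => TotalSpace.mk' ℂ y (σ y)) x

/-- A vector field on `M` that is smooth at `x`. -/
def SmoothVectorFieldAt [IsManifold 𝓘(ℂ, E) ω M] (X : Π x : M, TangentSpace 𝓘(ℝ, E) x) (x : M) :
    Prop :=
  ContMDiffAt 𝓘(ℝ, E) (𝓘(ℝ, E).prod 𝓘(ℝ, E)) ∞ (fun y => TotalSpace.mk' E y (X y)) x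

/-- The fibrewise Hermitian products of `L` form a smooth Hermitian structure. -/
def IsSmoothHermitian (E : Type*) [NormedAddCommGroup E] [NormedSpace ℂ E]
    [ChartedSpace E M] (L : M → Type*) [∀ x, NormedAddCommGroup (L x)]
    [∀ x, InnerProductSpace ℂ (L x)] [TopologicalSpace (TotalSpace ℂ L)] [FiberBundle ℂ L] :
    Prop :=
  ∀ (σ τ : Π x : M, L x) (x : M), SmoothSectionAt E σ x → SmoothSectionAt E τ x →
    ContMDiffAt 𝓘(ℝ, E) 𝓘(ℝ, ℂ) ∞ (fun y => inner ℂ (σ y) (τ y)) x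

variable [IsManifold 𝓘(ℂ, E) ω M] [VectorBundle ℂ ℂ L]

/-- `cov` is a prequantization connection on the Hermitian line bundle `L` over `(M, Ω)`: a smooth
`ℂ`-linear Hermitian connection whose curvature form is `2πi Ω`. -/
structure IsPrequantumConnection (Ω : Form E M 2) (cov : CovariantDerivative 𝓘(ℝ, E) ℂ L) :
    Prop where
  smooth : CovariantDerivative.ContMDiffCovariantDerivative cov ∞
  map_complex_smul : ∀ (c : ℂ) (σ : Π x : M, L x) (x : M), SmoothSectionAt E σ x →
    ∀ v, cov (c • σ) x v = c • cov σ x v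
  hermitian : ∀ (σ τ : Π x : M, L x) (x : M), SmoothSectionAt E σ x → SmoothSectionAt E τ x →
    ∀ v, mvfderiv 𝓘(ℝ, E) (fun y => inner ℂ (σ y) (τ y)) x v =
      inner ℂ (cov σ x v) (τ x) + inner ℂ (σ x) (cov τ x v)
  curvature : ∀ (X Y : Π x : M, TangentSpace 𝓘(ℝ, E) x) (σ : Π x : M, L x) (x : M),
    SmoothVectorFieldAt X x → SmoothVectorFieldAt Y x → SmoothSectionAt E σ x →
    cov (fun y => cov σ y (Y y)) x (X x) - cov (fun y => cov σ y (X y)) x (Y x)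
        - cov σ x (VectorField.mlieBracket 𝓘(ℝ, E) X Y x) =
      (2 * Real.pi * Complex.I * (Ω x ![X x, Y x] : ℂ)) • σ x

/-- `s` is a holomorphic section for the holomorphic structure that `cov` induces on `L`: it is
smooth and the `(0,1)`-part of its covariant derivative vanishes. -/
def IsHolomorphicSection (cov : CovariantDerivative 𝓘(ℝ, E) ℂ L) (s : Π x : M, L x) : Prop :=
  (∀ x, SmoothSectionAt E s x) ∧
    ∀ x (v : TangentSpace 𝓘(ℝ, E) x), cov s x (complexStructure x v) = Complex.I • cov s x v

/-- The zero set `D_s` of a section. -/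
def zeroSet (s : Π x : M, L x) : Set M := {x | s x = 0}

/-- The complex `1`-form `ρ_s = ⟨∇s, s⟩ / ⟨s, s⟩`, meaningful off the zero set of `s`. (`inner ℂ` is
linear in its second argument.) -/
def rho (cov : CovariantDerivative 𝓘(ℝ, E) ℂ L) (s : Π x : M, L x) (x : M) :
    TangentSpace 𝓘(ℝ, E) x →L[ℝ] ℂ :=
  (inner ℂ (s x) (s x))⁻¹ • ((innerSL ℂ (s x)).restrictScalars ℝ ∘L cov s x)

/-- The calibrating form `Im ρ_s`. -/
def imRho (cov : CovariantDerivative 𝓘(ℝ, E) ℂ L) (s : Π x : M, L x) (x : M) :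
    TangentSpace 𝓘(ℝ, E) x →L[ℝ] ℝ :=
  Complex.imCLM ∘L rho cov s x

/-- The function `φ_s = -(1/2π) ln |s|`, meaningful off the zero set of `s`. -/
def potential (s : Π x : M, L x) (x : M) : ℝ := -(1 / (2 * Real.pi)) * Real.log ‖s x‖

/-! ### Lagrangian submanifolds and the special Bohr–Sommerfeld condition

An embedded submanifold is given by a smooth embedding `ι : S → M`. -/

variable {F : Type*} [NormedAddCommGroup F] [NormedSpace ℝ F]
  {S : Type*} [TopologicalSpace S] [ChartedSpace F S]

/-- `ι : S → M` is a Lagrangian submanifold: a smooth embedding of a manifold of half the real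
dimension of `M` on which `Ω` restricts to zero. -/
structure IsLagrangian (Ω : Form E M 2) (ι : S → M) : Prop where
  embedding : Manifold.IsSmoothEmbedding 𝓘(ℝ, F) 𝓘(ℝ, E) ∞ ι
  half_dim : Module.finrank ℝ F = Module.finrank ℂ E
  isotropic : ∀ p (u v : TangentSpace 𝓘(ℝ, F) p),
    Ω (ι p) ![mfderiv 𝓘(ℝ, F) 𝓘(ℝ, E) ι p u, mfderiv 𝓘(ℝ, F) 𝓘(ℝ, E) ι p v] = 0

/-- The local frame of the line bundle `L` near `b` given by the trivialization of `L` at `b`. -/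
def localFrame (L : M → Type*) [∀ x, NormedAddCommGroup (L x)] [∀ x, InnerProductSpace ℂ (L x)]
    [TopologicalSpace (TotalSpace ℂ L)] [FiberBundle ℂ L] (b x : M) : L x :=
  (trivializationAt ℂ L b).symm x (1 : ℂ)

/-- The component of the section `σ` of `ι^* L` in the local frame of `L` near `b`, i.e. the function
`g` with `σ = g · (e ∘ ι)` near the preimage of `b`, where `e` is the frame. -/
def frameComponent (ι : S → M) (σ : Π p : S, L (ι p)) (b : M) (q : S) : ℂ :=
  (trivializationAt ℂ L b ⟨ι q, σ q⟩).2

/-- The pulled-back connection `ι^* cov` on the bundle `ι^* L` over `S`: if `σ = g · (e ∘ ι)` near `p`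
for the local frame `e` of `L` near `ι p`, then
`(ι^*∇)_v σ = dg(v) e(ι p) + g(p) (∇_{dι(v)} e)(ι p)`. -/
def restrictedConnection (cov : CovariantDerivative 𝓘(ℝ, E) ℂ L) (ι : S → M)
    (σ : Π p : S, L (ι p)) (p : S) (v : TangentSpace 𝓘(ℝ, F) p) : L (ι p) :=
  mvfderiv 𝓘(ℝ, F) (frameComponent ι σ (ι p)) p v • localFrame L (ι p) (ι p) +
    frameComponent ι σ (ι p) p •
      cov (localFrame L (ι p)) (ι p) (mfderiv 𝓘(ℝ, F) 𝓘(ℝ, E) ι p v)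

/-- `σ` is a covariantly constant (smooth, nowhere vanishing) section of `L` over `S`. -/
structure IsCovariantlyConstant (cov : CovariantDerivative 𝓘(ℝ, E) ℂ L) (ι : S → M)
    (σ : Π p : S, L (ι p)) : Prop where
  smooth : ContMDiff 𝓘(ℝ, F) (𝓘(ℝ, E).prod 𝓘(ℝ, ℂ)) ∞ (fun p => TotalSpace.mk' ℂ (ι p) (σ p))
  ne_zero : ∀ p, σ p ≠ 0
  parallel : ∀ p (v : TangentSpace 𝓘(ℝ, F) p), restrictedConnection cov ι σ p v = 0

/-- `S` is a special Bohr–Sommerfeld submanifold with respect to the section `s`: the restriction of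
`(L, cov)` to `S` has a covariantly constant section `σ`, the section `s` does not vanish on `S`, and
`s|_S = f e^{ic} σ` with a real constant `c` and a positive real function `f`. -/
def IsSpecialBohrSommerfeld (F : Type*) [NormedAddCommGroup F] [NormedSpace ℝ F]
    [ChartedSpace F S] (cov : CovariantDerivative 𝓘(ℝ, E) ℂ L) (s : Π x : M, L x) (ι : S → M) :
    Prop :=
  (∀ p, s (ι p) ≠ 0) ∧
    ∃ σ : Π p : S, L (ι p), IsCovariantlyConstant (F := F) cov ι σ ∧
      ∃ (c : ℝ) (f : S → ℝ), (∀ p, 0 < f p) ∧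
        ∀ p, s (ι p) = ((f p : ℂ) * Complex.exp (Complex.I * c)) • σ p

/-- `A` is preserved by the flow of the vector field `X` on `U`: an integral curve of `X` in `U`,
defined on an open interval, that meets `A` stays in `A`. -/
def IsPreservedByFlow (X : Π x : M, TangentSpace 𝓘(ℝ, E) x) (U A : Set M) : Prop :=
  ∀ (γ : ℝ → M) (a b : ℝ), IsMIntegralCurveOn γ X (Ioo a b) → MapsTo γ (Ioo a b) U →
    ∀ t₀ ∈ Ioo a b, γ t₀ ∈ A → ∀ t ∈ Ioo a b, γ t ∈ A

end Bundle

end SBS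

end

set_option linter.unusedSectionVars false

open Set Bundle
open scoped Manifold ContDiff Topology

noncomputable section

namespace SBS

/-! ### Holomorphic charts as real charts, and vector fields constant in a chart. -/

section Charts

variable {E : Type*} [NormedAddCommGroup E] [NormedSpace ℂ E]
  {M : Type*} [TopologicalSpace M] [ChartedSpace E M]

/-! Off `D_s` the section is itself a frame of the line bundle, so `∇s = ρ s`, and everything is
read off from `ρ`. Compatibility with the Hermitian product gives `Re ρ = d ln|s|` (`re_rho`).
Holomorphy of `s` says that `ρ(Iv) = iρ(v)`, so `Im ρ = -I d ln|s| = 2π I dφ` (`imRho_eq`). The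
curvature of `∇` applied to `s` is `dρ`, hence `dρ = 2πiΩ`. Its imaginary part is `d(I dφ) = Ω`. In
a chart this is an identity between second derivatives of `φ` (`hessian_log_norm`,
`hessian_potential`), and on the pair `(Iv, v)` it says that four times the Levi form is `Ω(Iv, v) >
0`. The special Bohr–Sommerfeld condition means that `Im ρ` vanishes on `S`: if it does, then
`s/|s|` is parallel along `S`; conversely, if `s = f e^{ic} σ` with `σ` parallel, then `ρ` restricts
to the real form `df/f`. Since `I` preserves `Ω`, `Im ρ = 2π Ω(grad φ, ·)` (`imRho_eq_gradient`).
Thus the condition says that `grad φ` is `Ω`-orthogonal to `TS`, and a Lagrangian subspace is its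
own orthogonal. The last part is the equivalence of tangency and invariance for a smooth vector
field along a compact embedded submanifold: local uniqueness of integral curves in one direction,
differentiation of an integral curve in the other. -/

theorem hasMFDerivAt_restrictScalars
    {E' : Type*} [NormedAddCommGroup E'] [NormedSpace ℂ E']
    {M' : Type*} [TopologicalSpace M'] [ChartedSpace E' M'] {f : M → M'} {x : M}
    {f' : TangentSpace 𝓘(ℂ, E) x →L[ℂ] TangentSpace 𝓘(ℂ, E') (f x)}
    (h : HasMFDerivAt 𝓘(ℂ, E) 𝓘(ℂ, E') f x f') :
    HasMFDerivAt 𝓘(ℝ, E) 𝓘(ℝ, E') f x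
      (ContinuousLinearMap.restrictScalars ℝ (show E →L[ℂ] E' from f') : E →L[ℝ] E') := by
  refine ⟨h.1, ?_⟩
  have h2 : HasFDerivWithinAt (writtenInExtChartAt 𝓘(ℂ, E) 𝓘(ℂ, E') x f)
    (show E →L[ℂ] E' from f') (range 𝓘(ℂ, E)) (extChartAt 𝓘(ℂ, E) x x) := h.2
  exact h2.restrictScalars ℝ

theorem mem_maximalAtlas_real {e : OpenPartialHomeomorph M E}
    (he : e ∈ IsManifold.maximalAtlas 𝓘(ℂ, E) ω M) :
    e ∈ IsManifold.maximalAtlas 𝓘(ℝ, E) ∞ M := by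
  have key : ∀ f : OpenPartialHomeomorph E E, f ∈ contDiffGroupoid ω 𝓘(ℂ, E) →
      f ∈ contDiffGroupoid ∞ 𝓘(ℝ, E) := by
    intro f hf
    have h1 : ContDiffOn ℂ ω (𝓘(ℂ, E) ∘ f ∘ 𝓘(ℂ, E).symm)
      (𝓘(ℂ, E).symm ⁻¹' f.source ∩ range 𝓘(ℂ, E)) := hf.1
    have h2 : ContDiffOn ℂ ω (𝓘(ℂ, E) ∘ f.symm ∘ 𝓘(ℂ, E).symm)
      (𝓘(ℂ, E).symm ⁻¹' f.target ∩ range 𝓘(ℂ, E)) := hf.2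
    exact ⟨(h1.restrict_scalars ℝ).of_le le_top, (h2.restrict_scalars ℝ).of_le le_top⟩
  intro e' he'
  exact ⟨key _ (he e' he').1, key _ (he e' he').2⟩

theorem mdifferentiable_of_mem_maximalAtlas [IsManifold 𝓘(ℂ, E) ω M]
    {e : OpenPartialHomeomorph M E}
    (he : e ∈ IsManifold.maximalAtlas 𝓘(ℂ, E) ω M) : e.MDifferentiable 𝓘(ℝ, E) 𝓘(ℝ, E) :=
  ⟨(contMDiffOn_of_mem_maximalAtlas (mem_maximalAtlas_real he)).mdifferentiableOn (by simp),
   (contMDiffOn_symm_of_mem_maximalAtlas (mem_maximalAtlas_real he)).mdifferentiableOn (by simp)⟩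

/-- A vector field on the model space. -/
def modelField (G : E → E) (y : E) : TangentSpace 𝓘(ℝ, E) y := G y

/-- The vector field whose expression in the chart `e` is `G`. -/
def pullbackField (e : OpenPartialHomeomorph M E) (G : E → E) :
    Π x : M, TangentSpace 𝓘(ℝ, E) x :=
  VectorField.mpullback 𝓘(ℝ, E) 𝓘(ℝ, E) e (modelField G)

/-- The vector field that is constant equal to `u` in the chart `e`. -/
abbrev chartField (e : OpenPartialHomeomorph M E) (u : E) : Π x : M, TangentSpace 𝓘(ℝ, E) x :=
  pullbackField e fun _ => u

theorem mvfderiv_eq_mfderiv {V : Type*} [NormedAddCommGroup V] [NormedSpace ℝ V]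
    {N : Type*} [TopologicalSpace N] [ChartedSpace V N]
    {F : Type*} [NormedAddCommGroup F] [NormedSpace ℝ F] (f : N → F)
    (x : N) (v : TangentSpace 𝓘(ℝ, V) x) :
    mvfderiv 𝓘(ℝ, V) f x v = (show F from mfderiv 𝓘(ℝ, V) 𝓘(ℝ, F) f x v) := rfl

/-- `complexStructure` is multiplication by `i` in the preferred chart only. It has the same form in
every holomorphic chart because the real differential of such a chart is its complex differential
with scalars restricted. -/
theorem mvfderiv_chart_complexStructure
    {e : OpenPartialHomeomorph M E} (he : e ∈ IsManifold.maximalAtlas 𝓘(ℂ, E) ω M) {x : M} (hx : x ∈ e.source)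
    (v : TangentSpace 𝓘(ℝ, E) x) :
    mvfderiv 𝓘(ℝ, E) e x (complexStructure x v) = Complex.I • mvfderiv 𝓘(ℝ, E) e x v := by
  have h := (contMDiffAt_of_mem_maximalAtlas he hx).mdifferentiableAt (by simp)
  have h' := hasMFDerivAt_restrictScalars h.hasMFDerivAt
  rw [mvfderiv_eq_mfderiv, mvfderiv_eq_mfderiv, h'.mfderiv]
  exact map_smul (show E →L[ℂ] E from mfderiv 𝓘(ℂ, E) 𝓘(ℂ, E) e x) Complex.I (show E from v)

variable [IsManifold 𝓘(ℂ, E) ω M] {e : OpenPartialHomeomorph M E}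

theorem isInvertible_mfderiv_chart (he : e ∈ IsManifold.maximalAtlas 𝓘(ℂ, E) ω M)
    {x : M} (hx : x ∈ e.source) : (mfderiv 𝓘(ℝ, E) 𝓘(ℝ, E) e x).IsInvertible :=
  ⟨(mdifferentiable_of_mem_maximalAtlas he).mfderiv hx, rfl⟩

theorem mvfderiv_chart_injective (he : e ∈ IsManifold.maximalAtlas 𝓘(ℂ, E) ω M)
    {x : M} (hx : x ∈ e.source) : Function.Injective (mvfderiv 𝓘(ℝ, E) e x) :=
  (mdifferentiable_of_mem_maximalAtlas he).mfderiv_injective hx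

theorem mvfderiv_pullbackField (he : e ∈ IsManifold.maximalAtlas 𝓘(ℂ, E) ω M)
    {x : M} (hx : x ∈ e.source) (G : E → E) :
    mvfderiv 𝓘(ℝ, E) e x (pullbackField e G x) = G (e x) := by
  obtain ⟨A, hA⟩ := isInvertible_mfderiv_chart he hx
  rw [mvfderiv_eq_mfderiv, pullbackField, VectorField.mpullback_apply, ← hA,
    ContinuousLinearMap.inverse_equiv]
  exact A.apply_symm_apply (modelField G (e x))

theorem eq_chartField (he : e ∈ IsManifold.maximalAtlas 𝓘(ℂ, E) ω M)
    {x : M} (hx : x ∈ e.source) (v : TangentSpace 𝓘(ℝ, E) x) :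
    v = chartField e (mvfderiv 𝓘(ℝ, E) e x v) x :=
  mvfderiv_chart_injective he hx (mvfderiv_pullbackField he hx fun _ => _).symm

theorem chartField_I_smul (he : e ∈ IsManifold.maximalAtlas 𝓘(ℂ, E) ω M)
    {x : M} (hx : x ∈ e.source) (u : E) :
    chartField e (Complex.I • u) x = complexStructure x (chartField e u x) := by
  refine mvfderiv_chart_injective he hx ?_
  rw [mvfderiv_chart_complexStructure he hx, mvfderiv_pullbackField he hx,
    mvfderiv_pullbackField he hx]

theorem chartField_ne_zero (he : e ∈ IsManifold.maximalAtlas 𝓘(ℂ, E) ω M)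
    {x : M} (hx : x ∈ e.source) {u : E} (hu : u ≠ 0) : chartField e u x ≠ 0 := by
  intro h
  exact hu ((mvfderiv_pullbackField he hx fun _ => u).symm.trans
    ((congrArg _ h).trans (map_zero _)))

theorem smoothVectorFieldAt_pullbackField [FiniteDimensional ℂ E]
    (he : e ∈ IsManifold.maximalAtlas 𝓘(ℂ, E) ω M)
    {x : M} (hx : x ∈ e.source) {G : E → E} (hG : ContDiffAt ℝ ∞ G (e x)) :
    SmoothVectorFieldAt (pullbackField e G) x := by
  have : FiniteDimensional ℝ E := FiniteDimensional.complexToReal E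
  have : CompleteSpace E := FiniteDimensional.complete ℝ E
  refine ContMDiffAt.mpullback_vectorField_preimage (m := ∞) (n := ∞) ?_
    (contMDiffAt_of_mem_maximalAtlas (mem_maximalAtlas_real he) hx)
    (isInvertible_mfderiv_chart he hx) le_rfl
  exact contMDiffAt_vectorSpace_iff_contDiffAt.2 hG

/-- Pull-back commutes with the bracket, and constant fields on a vector space commute. This removes
the bracket term from the curvature identity. -/
theorem mlieBracket_chartField [FiniteDimensional ℂ E]
    (he : e ∈ IsManifold.maximalAtlas 𝓘(ℂ, E) ω M)
    {x : M} (hx : x ∈ e.source) (u v : E) :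
    VectorField.mlieBracket 𝓘(ℝ, E) (chartField e u) (chartField e v) x = 0 := by
  have : FiniteDimensional ℝ E := FiniteDimensional.complexToReal E
  have : CompleteSpace E := FiniteDimensional.complete ℝ E
  have hm : IsManifold 𝓘(ℝ, E) (minSmoothness ℝ 2) M := by
    simpa using IsManifold.of_le (I := 𝓘(ℝ, E)) (M := M) (m := 2) (n := ∞) (by norm_cast)
  have hm : IsManifold 𝓘(ℝ, E) (minSmoothness ℝ 3) M := by
    simpa using IsManifold.of_le (I := 𝓘(ℝ, E)) (M := M) (m := 3) (n := ∞) (by norm_cast)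
  have h0 : ∀ u : E, MDifferentiableAt 𝓘(ℝ, E) (𝓘(ℝ, E).prod 𝓘(ℝ, E))
      (fun y : E => (TotalSpace.mk' E y (modelField (fun _ => u) y) : TangentBundle 𝓘(ℝ, E) E))
      (e x) := fun u =>
    (contMDiffAt_vectorSpace_iff_contDiffAt (n := 1).2
      (contDiffAt_const : ContDiffAt ℝ 1 (fun _ : E => u) (e x))).mdifferentiableAt (by simp)
  have h := VectorField.mpullback_mlieBracket (I := 𝓘(ℝ, E)) (I' := 𝓘(ℝ, E)) (n := ∞) (f := e)
    (h0 u) (h0 v)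
    (contMDiffAt_of_mem_maximalAtlas (mem_maximalAtlas_real he) hx) (by simp; norm_cast)
  refine h.symm.trans ?_
  rw [VectorField.mpullback_apply, ← VectorField.mlieBracketWithin_univ,
    VectorField.mlieBracketWithin_eq_lieBracketWithin]
  have : VectorField.lieBracketWithin ℝ (fun _ : E => u) (fun _ : E => v) univ (e x) = 0 := by
    simp [VectorField.lieBracketWithin]
  exact (congrArg _ this).trans (map_zero _)

end Charts

/-! ### Chain and product rules for vector-valued functions. -/

section RealDerivative

variable {V : Type*} [NormedAddCommGroup V] [NormedSpace ℝ V]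
  {N : Type*} [TopologicalSpace N] [ChartedSpace V N]

theorem mvfderiv_comp_of_hasFDerivAt {F G : Type*} [NormedAddCommGroup F] [NormedSpace ℝ F]
    [NormedAddCommGroup G] [NormedSpace ℝ G] {A : F → G} {A' : F →L[ℝ] G} {g : N → F} {x : N}
    (hA : HasFDerivAt A A' (g x)) (hg : MDifferentiableAt 𝓘(ℝ, V) 𝓘(ℝ, F) g x)
    (v : TangentSpace 𝓘(ℝ, V) x) :
    mvfderiv 𝓘(ℝ, V) (fun y => A (g y)) x v = A' (mvfderiv 𝓘(ℝ, V) g x v) := by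
  have hA : HasMFDerivAt 𝓘(ℝ, F) 𝓘(ℝ, G) A (g x) A' := hA.hasMFDerivAt
  have h := (hA.comp x hg.hasMFDerivAt).mfderiv
  have h' : mfderiv 𝓘(ℝ, V) 𝓘(ℝ, G) (fun y => A (g y)) x =
    ContinuousLinearMap.comp (A' : TangentSpace 𝓘(ℝ, F) (g x) →L[ℝ] TangentSpace 𝓘(ℝ, G) (A (g x)))
      (mfderiv 𝓘(ℝ, V) 𝓘(ℝ, F) g x) := h
  rw [mvfderiv_eq_mfderiv, mvfderiv_eq_mfderiv, h']
  rfl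

theorem contMDiffAt_complex_mul {f g : N → ℂ} {x : N} (hf : ContMDiffAt 𝓘(ℝ, V) 𝓘(ℝ, ℂ) ∞ f x)
    (hg : ContMDiffAt 𝓘(ℝ, V) 𝓘(ℝ, ℂ) ∞ g x) :
    ContMDiffAt 𝓘(ℝ, V) 𝓘(ℝ, ℂ) ∞ (fun y => f y * g y) x :=
  ((contDiff_mul (𝕜 := ℝ) (𝔸 := ℂ) (n := ∞)).contMDiff.contMDiffAt (x := (f x, g x))).comp x
    (hf.prodMk_space hg)

theorem mvfderiv_complex_mul {f g : N → ℂ} {x : N} (hf : MDifferentiableAt 𝓘(ℝ, V) 𝓘(ℝ, ℂ) f x)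
    (hg : MDifferentiableAt 𝓘(ℝ, V) 𝓘(ℝ, ℂ) g x) (v : TangentSpace 𝓘(ℝ, V) x) :
    mvfderiv 𝓘(ℝ, V) (fun y => f y * g y) x v =
      f x * mvfderiv 𝓘(ℝ, V) g x v + g x * mvfderiv 𝓘(ℝ, V) f x v := by
  have h := (hf.hasMFDerivAt.mul hg.hasMFDerivAt).mfderiv
  exact congrArg (fun A : V →L[ℝ] ℂ => A v) h

end RealDerivative

/-! ### The connection in a frame, and the form `ρ_s` off the zero set. -/

section Connection

variable {E : Type*} [NormedAddCommGroup E] [NormedSpace ℂ E]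
  {M : Type*} [TopologicalSpace M] [ChartedSpace E M]
  {L : M → Type*} [∀ x, NormedAddCommGroup (L x)] [∀ x, InnerProductSpace ℂ (L x)]
  [TopologicalSpace (TotalSpace ℂ L)] [FiberBundle ℂ L]

/-- The coordinate of a vector of `L` in the trivialization of `L` at `b`. -/
def fiberCoord (b : M) {y : M} (v : L y) : ℂ := (trivializationAt ℂ L b ⟨y, v⟩).2

theorem smoothSectionAt_iff {σ : Π x : M, L x} {x : M} :
    SmoothSectionAt E σ x ↔
      ContMDiffAt 𝓘(ℝ, E) 𝓘(ℝ, ℂ) ∞ (fun y => fiberCoord x (σ y)) x :=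
  contMDiffAt_section x

theorem mem_baseSet_nhds (b : M) : (trivializationAt ℂ L b).baseSet ∈ 𝓝 b :=
  (trivializationAt ℂ L b).open_baseSet.mem_nhds (FiberBundle.mem_baseSet_trivializationAt ℂ L b)

theorem fiberCoord_localFrame {b y : M} (hy : y ∈ (trivializationAt ℂ L b).baseSet) :
    fiberCoord b (localFrame L b y) = 1 := by
  rw [fiberCoord, localFrame, (trivializationAt ℂ L b).apply_mk_symm hy]

variable [VectorBundle ℂ ℂ L]

theorem fiberCoord_smul {b y : M} (hy : y ∈ (trivializationAt ℂ L b).baseSet) (c : ℂ) (v : L y) :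
    fiberCoord b (c • v) = c * fiberCoord b v :=
  ((trivializationAt ℂ L b).linear ℂ hy).map_smul c v

theorem fiberCoord_injective {b y : M} (hy : y ∈ (trivializationAt ℂ L b).baseSet) :
    Function.Injective (fiberCoord b : L y → ℂ) :=
  ((trivializationAt ℂ L b).linearEquivAt ℂ y hy).injective

theorem fiberCoord_eq_zero {b y : M} (hy : y ∈ (trivializationAt ℂ L b).baseSet) {v : L y} :
    fiberCoord b v = 0 ↔ v = 0 :=
  ((trivializationAt ℂ L b).linearEquivAt ℂ y hy).map_eq_zero_iff

theorem fiberCoord_smul_localFrame {b y : M} (hy : y ∈ (trivializationAt ℂ L b).baseSet)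
    (v : L y) : fiberCoord b v • localFrame L b y = v := by
  apply fiberCoord_injective hy
  rw [fiberCoord_smul hy, fiberCoord_localFrame hy, mul_one]

theorem exists_eq_smul {x : M} {v w : L x} (hv : v ≠ 0) : ∃ c : ℂ, w = c • v := by
  have hx := FiberBundle.mem_baseSet_trivializationAt ℂ L x
  refine ⟨fiberCoord x w / fiberCoord x v, fiberCoord_injective hx ?_⟩
  rw [fiberCoord_smul hx, div_mul_cancel₀ _ (mt (fiberCoord_eq_zero hx).1 hv)]

theorem SmoothSectionAt.complex_smul {σ : Π x : M, L x} {x : M} {g : M → ℂ}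
    (hσ : SmoothSectionAt E σ x) (hg : ContMDiffAt 𝓘(ℝ, E) 𝓘(ℝ, ℂ) ∞ g x) :
    SmoothSectionAt E (fun y => g y • σ y) x := by
  rw [smoothSectionAt_iff] at hσ ⊢
  refine (contMDiffAt_complex_mul hg hσ).congr_of_eventuallyEq ?_
  filter_upwards [mem_baseSet_nhds (L := L) x] with y hy
  exact fiberCoord_smul hy _ _

theorem smoothSectionAt_localFrame (b : M) : SmoothSectionAt E (localFrame L b) b := by
  rw [smoothSectionAt_iff]
  refine (contMDiffAt_const (c := (1 : ℂ))).congr_of_eventuallyEq ?_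
  filter_upwards [mem_baseSet_nhds (L := L) b] with y hy
  exact fiberCoord_localFrame hy

theorem SmoothSectionAt.mdifferentiableAt {σ : Π x : M, L x} {x : M}
    (hσ : SmoothSectionAt E σ x) :
    MDifferentiableAt 𝓘(ℝ, E) (𝓘(ℝ, E).prod 𝓘(ℝ, ℂ)) (fun y => TotalSpace.mk' ℂ y (σ y)) x :=
  ContMDiffAt.mdifferentiableAt hσ (by simp)

variable [IsManifold 𝓘(ℂ, E) ω M] {Ω : Form E M 2} {cov : CovariantDerivative 𝓘(ℝ, E) ℂ L}

/-- The Leibniz rule built into `cov` concerns real functions. Writing `g σ = (Re g) σ + (Im g) (i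
σ)` and using complex linearity of the connection extends it to complex `g`. -/
theorem cov_complex_smul (hcov : IsPrequantumConnection Ω cov) {σ : Π x : M, L x} {x : M}
    {g : M → ℂ} (hg : MDifferentiableAt 𝓘(ℝ, E) 𝓘(ℝ, ℂ) g x) (hσ : SmoothSectionAt E σ x)
    (v : TangentSpace 𝓘(ℝ, E) x) :
    cov (fun y => g y • σ y) x v = g x • cov σ x v + mvfderiv 𝓘(ℝ, E) g x v • σ x := by
  have hre : MDifferentiableAt 𝓘(ℝ, E) 𝓘(ℝ, ℝ) (fun y => (g y).re) x :=
    (Complex.reCLM.contMDiff (n := 1)).mdifferentiableAt (by simp) |>.comp x hg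
  have him : MDifferentiableAt 𝓘(ℝ, E) 𝓘(ℝ, ℝ) (fun y => (g y).im) x :=
    (Complex.imCLM.contMDiff (n := 1)).mdifferentiableAt (by simp) |>.comp x hg
  have hI : SmoothSectionAt E (Complex.I • σ) x := hσ.complex_smul contMDiffAt_const
  have e1 : (fun y => g y • σ y) =
      (fun y => (g y).re) • σ + (fun y => (g y).im) • (Complex.I • σ) := by
    funext y
    simp only [Pi.add_apply, Pi.smul_apply', Pi.smul_apply]
    rw [← Complex.coe_smul, ← Complex.coe_smul, smul_smul, ← add_smul, Complex.re_add_im]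
  rw [e1, cov.isCovariantDerivativeOnUniv.add (hre.smul_section hσ.mdifferentiableAt)
    (him.smul_section hI.mdifferentiableAt),
    cov.isCovariantDerivativeOnUniv.leibniz hσ.mdifferentiableAt hre,
    cov.isCovariantDerivativeOnUniv.leibniz hI.mdifferentiableAt him]
  simp only [add_apply, smul_apply,
    ContinuousLinearMap.smulRight_apply, Pi.smul_apply]
  have e2 := hcov.map_complex_smul Complex.I σ x hσ v
  have e3 : mvfderiv 𝓘(ℝ, E) (fun y => (g y).re) x v = (mvfderiv 𝓘(ℝ, E) g x v).re :=
    mvfderiv_comp_of_hasFDerivAt Complex.reCLM.hasFDerivAt hg v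
  have e4 : mvfderiv 𝓘(ℝ, E) (fun y => (g y).im) x v = (mvfderiv 𝓘(ℝ, E) g x v).im :=
    mvfderiv_comp_of_hasFDerivAt Complex.imCLM.hasFDerivAt hg v
  rw [e3, e4]
  have e2' : cov.toFun (Complex.I • σ) x v = Complex.I • cov.toFun σ x v := e2
  rw [e2']
  conv_rhs => rw [← Complex.re_add_im (g x), ← Complex.re_add_im (mvfderiv 𝓘(ℝ, E) g x v)]
  simp only [← Complex.coe_smul, add_smul, mul_smul]
  abel

theorem cov_congr {σ τ : Π x : M, L x} {x : M} (hσ : SmoothSectionAt E σ x)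
    (h : ∀ᶠ y in 𝓝 x, τ y = σ y) : cov τ x = cov σ x := by
  have hτ : SmoothSectionAt E τ x := by
    refine ContMDiffAt.congr_of_eventuallyEq hσ ?_
    filter_upwards [h] with y hy
    rw [hy]
  exact cov.isCovariantDerivativeOnUniv.congr_of_eventuallyEq hτ.mdifferentiableAt
    hσ.mdifferentiableAt Filter.univ_mem h

/-- The fibre is a complex line spanned by `s x`, so `∇s` is a multiple of `s`; pairing with `s`
identifies the factor. -/
theorem cov_eq_rho_smul {s : Π x : M, L x} {x : M} (hx : s x ≠ 0) (v : TangentSpace 𝓘(ℝ, E) x) :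
    cov s x v = rho cov s x v • s x := by
  obtain ⟨c, hc⟩ := exists_eq_smul (w := cov s x v) hx
  have h0 : (inner ℂ (s x) (s x) : ℂ) ≠ 0 := inner_self_ne_zero.2 hx
  have : rho cov s x v = c := by
    have : rho cov s x v = (inner ℂ (s x) (s x))⁻¹ * inner ℂ (s x) (cov s x v) := rfl
    rw [this, hc, inner_smul_right, mul_comm c, inv_mul_cancel_left₀ h0]
  rw [this, hc]

theorem rho_complexStructure {s : Π x : M, L x} (hs : IsHolomorphicSection cov s) (x : M)
    (v : TangentSpace 𝓘(ℝ, E) x) :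
    rho cov s x (complexStructure x v) = Complex.I * rho cov s x v := by
  have e : ∀ w, rho cov s x w = (inner ℂ (s x) (s x))⁻¹ * inner ℂ (s x) (cov s x w) :=
    fun w => rfl
  rw [e, e, hs.2, inner_smul_right]
  ring

/-- The norm is accessible only through the smooth function `⟨s, s⟩ = |s|²`, hence the form `ln|s| =
½ ln ⟨s, s⟩`. -/
theorem contMDiffAt_log_norm (hL : IsSmoothHermitian E L) {s : Π x : M, L x} {x : M}
    (hs : SmoothSectionAt E s x) (hx : s x ≠ 0) :
    ContMDiffAt 𝓘(ℝ, E) 𝓘(ℝ) ∞ (fun y => Real.log ‖s y‖) x := by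
  have h1 := hL s s x hs hs
  have h2 : ContMDiffAt 𝓘(ℝ, E) 𝓘(ℝ) ∞ (fun y => (inner ℂ (s y) (s y) : ℂ).re) x :=
    (Complex.reCLM.contMDiff (n := ∞)).contMDiffAt.comp x h1
  have h3 : (fun y => (inner ℂ (s y) (s y) : ℂ).re) = fun y => ‖s y‖ ^ 2 := by
    funext y
    rw [inner_self_eq_norm_sq_to_K]
    norm_cast
  rw [h3] at h2
  have h4 : ContDiffAt ℝ ∞ (fun t : ℝ => Real.log t / 2) (‖s x‖ ^ 2) :=
    (Real.contDiffAt_log.2 (by simpa using hx)).div_const 2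
  have h5 := (h4.contMDiffAt (n := ∞)).comp x h2
  refine h5.congr_of_eventuallyEq (Filter.Eventually.of_forall fun y => ?_)
  simp [Function.comp, Real.log_pow]

theorem re_rho (hL : IsSmoothHermitian E L) (hcov : IsPrequantumConnection Ω cov)
    {s : Π x : M, L x} {x : M}
    (hs : SmoothSectionAt E s x) (hx : s x ≠ 0) (v : TangentSpace 𝓘(ℝ, E) x) :
    (rho cov s x v).re = mvfderiv 𝓘(ℝ, E) (fun y => Real.log ‖s y‖) x v := by
  have h0 : ContMDiffAt 𝓘(ℝ, E) 𝓘(ℝ, ℂ) ∞ (fun y => (inner ℂ (s y) (s y) : ℂ)) x := hL s s x hs hs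
  -- The two terms of the Hermitian identity are conjugate to each other, so they add up to twice a
  -- real part.
  have h1 : mvfderiv 𝓘(ℝ, E) (fun y => (inner ℂ (s y) (s y) : ℂ)) x v =
      2 * (inner ℂ (s x) (cov s x v) : ℂ).re := by
    rw [hcov.hermitian s s x hs hs v, ← inner_conj_symm, add_comm, Complex.add_conj]
    push_cast
    rfl
  have h2 : (inner ℂ (s x) (s x) : ℂ) = (‖s x‖ ^ 2 : ℝ) := by
    rw [inner_self_eq_norm_sq_to_K]
    norm_cast
  have hn : ‖s x‖ ≠ 0 := by simpa using hx
  have h3 : HasFDerivAt (fun z : ℂ => Real.log z.re / 2)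
      ((2 : ℝ)⁻¹ • (‖s x‖ ^ 2)⁻¹ • Complex.reCLM) (inner ℂ (s x) (s x)) := by
    have hr : (inner ℂ (s x) (s x) : ℂ).re = ‖s x‖ ^ 2 := by rw [h2, Complex.ofReal_re]
    have := (Complex.reCLM.hasFDerivAt (x := inner ℂ (s x) (s x))).log
      (by rw [Complex.reCLM_apply, hr]; positivity)
    rw [Complex.reCLM_apply, hr] at this
    simpa [div_eq_inv_mul] using this.const_mul (2 : ℝ)⁻¹
  have h4 := mvfderiv_comp_of_hasFDerivAt
    (g := fun y => (inner ℂ (s y) (s y) : ℂ)) h3 (h0.mdifferentiableAt (by simp)) v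
  have h5 : (fun y => Real.log (inner ℂ (s y) (s y) : ℂ).re / 2) = fun y => Real.log ‖s y‖ := by
    funext y
    have : (inner ℂ (s y) (s y) : ℂ).re = ‖s y‖ ^ 2 := by
      rw [inner_self_eq_norm_sq_to_K]
      norm_cast
    rw [this, Real.log_pow]
    simp
  rw [h5, h1] at h4
  rw [h4]
  have h6 : rho cov s x v = (inner ℂ (s x) (s x))⁻¹ * inner ℂ (s x) (cov s x v) := rfl
  rw [h6, h2, ← Complex.ofReal_inv, Complex.re_ofReal_mul]
  simp
  ring

/-- The formula `Im ρ = -I d ln |s|`. -/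
theorem imRho_eq (hL : IsSmoothHermitian E L) (hcov : IsPrequantumConnection Ω cov)
    {s : Π x : M, L x} (hs : IsHolomorphicSection cov s) {x : M} (hx : s x ≠ 0) :
    imRho cov s x =
      -complexStructureForm (mvfderiv 𝓘(ℝ, E) (fun y => Real.log ‖s y‖)) x := by
  ext v
  have h1 : imRho cov s x v = (rho cov s x v).im := rfl
  have h2 : (-complexStructureForm (mvfderiv 𝓘(ℝ, E) (fun y => Real.log ‖s y‖)) x) v =
    -mvfderiv 𝓘(ℝ, E) (fun y => Real.log ‖s y‖) x (complexStructure x v) := rfl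
  rw [h1, h2, ← re_rho hL hcov (hs.1 x) hx, rho_complexStructure hs]
  simp

theorem isOpen_compl_zeroSet {s : Π x : M, L x} (hs : ∀ x, SmoothSectionAt E s x) :
    IsOpen (zeroSet s)ᶜ := by
  rw [isOpen_iff_mem_nhds]
  intro x hx
  have h := (smoothSectionAt_iff.1 (hs x)).continuousAt
  have h0 : fiberCoord x (s x) ≠ 0 :=
    mt (fiberCoord_eq_zero (FiberBundle.mem_baseSet_trivializationAt ℂ L x)).1 hx
  filter_upwards [h.eventually_ne h0, mem_baseSet_nhds (L := L) x] with y hy hy'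
  exact mt (fiberCoord_eq_zero hy').2 hy

theorem contMDiffOn_potential (hL : IsSmoothHermitian E L) {s : Π x : M, L x}
    (hs : ∀ x, SmoothSectionAt E s x) :
    ContMDiffOn 𝓘(ℝ, E) 𝓘(ℝ) ∞ (potential s) (zeroSet s)ᶜ := by
  intro x hx
  have h := contMDiffAt_log_norm hL (hs x) hx
  exact (((contDiff_const_smul (-(1 / (2 * Real.pi)) : ℝ)).contMDiff (n := ∞)).contMDiffAt.comp x
    h).contMDiffWithinAt

end Connection

/-! ### The curvature identity as a statement about second derivatives of `ln|s|`. -/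

section Curvature

variable {E : Type*} [NormedAddCommGroup E] [NormedSpace ℂ E] [FiniteDimensional ℂ E]
  {M : Type*} [TopologicalSpace M] [ChartedSpace E M] [IsManifold 𝓘(ℂ, E) ω M]
  {L : M → Type*} [∀ x, NormedAddCommGroup (L x)] [∀ x, InnerProductSpace ℂ (L x)]
  [TopologicalSpace (TotalSpace ℂ L)] [FiberBundle ℂ L] [VectorBundle ℂ ℂ L]
  {Ω : Form E M 2} {cov : CovariantDerivative 𝓘(ℝ, E) ℂ L}

theorem contDiffAt_comp_chart_symm {G : Type*} [NormedAddCommGroup G] [NormedSpace ℝ G]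
    {e : OpenPartialHomeomorph M E} (he : e ∈ IsManifold.maximalAtlas 𝓘(ℂ, E) ω M)
    {x : M} (hx : x ∈ e.source) {f : M → G} (hf : ContMDiffAt 𝓘(ℝ, E) 𝓘(ℝ, G) ∞ f x) :
    ContDiffAt ℝ ∞ (f ∘ e.symm) (e x) := by
  rw [← contMDiffAt_iff_contDiffAt]
  have h := contMDiffAt_symm_of_mem_maximalAtlas (mem_maximalAtlas_real he) (e.map_source hx)
  refine ContMDiffAt.comp _ ?_ h
  rwa [e.left_inv hx]

theorem mvfderiv_comp_chart {G : Type*} [NormedAddCommGroup G] [NormedSpace ℝ G]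
    {e : OpenPartialHomeomorph M E} (he : e ∈ IsManifold.maximalAtlas 𝓘(ℂ, E) ω M)
    {x : M} (hx : x ∈ e.source) {f : E → G} (hf : DifferentiableAt ℝ f (e x))
    (v : TangentSpace 𝓘(ℝ, E) x) :
    mvfderiv 𝓘(ℝ, E) (fun y => f (e y)) x v = fderiv ℝ f (e x) (mvfderiv 𝓘(ℝ, E) e x v) :=
  mvfderiv_comp_of_hasFDerivAt hf.hasFDerivAt
    ((mdifferentiable_of_mem_maximalAtlas he).mdifferentiableAt hx) v

/-- The differential of a function on `M`, computed in a chart. -/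
theorem mvfderiv_eq_fderiv_chart {G : Type*} [NormedAddCommGroup G] [NormedSpace ℝ G]
    {e : OpenPartialHomeomorph M E} (he : e ∈ IsManifold.maximalAtlas 𝓘(ℂ, E) ω M)
    {x : M} (hx : x ∈ e.source) {f : M → G} (hf : ContMDiffAt 𝓘(ℝ, E) 𝓘(ℝ, G) ∞ f x)
    (v : TangentSpace 𝓘(ℝ, E) x) :
    mvfderiv 𝓘(ℝ, E) f x v =
      fderiv ℝ (f ∘ e.symm) (e x) (mvfderiv 𝓘(ℝ, E) e x v) := by
  rw [← mvfderiv_comp_chart he hx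
    ((contDiffAt_comp_chart_symm he hx hf).differentiableAt (by simp))]
  have : f =ᶠ[𝓝 x] fun y => (f ∘ e.symm) (e y) := by
    filter_upwards [e.open_source.mem_nhds hx] with y hy
    simp [e.left_inv hy]
  rw [mvfderiv_eq_mfderiv, mvfderiv_eq_mfderiv, this.mfderiv_eq]
  simp only [Function.comp]
  rfl

/-- `ρ_s` on a field that is constant in a chart, in terms of the differential of `ln |s|`. -/
theorem rho_chartField (hL : IsSmoothHermitian E L) (hcov : IsPrequantumConnection Ω cov)
    {s : Π x : M, L x} (hs : IsHolomorphicSection cov s)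
    {e : OpenPartialHomeomorph M E} (he : e ∈ IsManifold.maximalAtlas 𝓘(ℂ, E) ω M)
    {x : M} (hx : x ∈ e.source) (hsx : s x ≠ 0) (u : E) :
    rho cov s x (chartField e u x) =
      fderiv ℝ ((fun y => Real.log ‖s y‖) ∘ e.symm) (e x) u -
        Complex.I * fderiv ℝ ((fun y => Real.log ‖s y‖) ∘ e.symm) (e x) (Complex.I • u) := by
  have hl := contMDiffAt_log_norm hL (hs.1 x) hsx
  have h1 : ∀ w : E, (rho cov s x (chartField e w x)).re =
      fderiv ℝ ((fun y => Real.log ‖s y‖) ∘ e.symm) (e x) w := fun w => by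
    rw [re_rho hL hcov (hs.1 x) hsx, mvfderiv_eq_fderiv_chart he hx hl,
      mvfderiv_pullbackField he hx]
  -- Since `ρ(Iu) = iρ(u)`, the real part of `ρ` at `Iu` is minus its imaginary part at `u`.
  have h2 := h1 (Complex.I • u)
  rw [chartField_I_smul he hx, rho_complexStructure hs] at h2
  rw [← h1 u, ← h2]
  apply Complex.ext <;> simp

/-- The curvature identity `dρ_s = 2πi Ω` in a chart. -/
theorem hessian_log_norm (hL : IsSmoothHermitian E L) (hcov : IsPrequantumConnection Ω cov)
    {s : Π x : M, L x} (hs : IsHolomorphicSection cov s)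
    {e : OpenPartialHomeomorph M E} (he : e ∈ IsManifold.maximalAtlas 𝓘(ℂ, E) ω M)
    {x : M} (hx : x ∈ e.source) (hsx : s x ≠ 0) (u v : E) :
    fderiv ℝ (fderiv ℝ ((fun y => Real.log ‖s y‖) ∘ e.symm)) (e x) v (Complex.I • u) -
      fderiv ℝ (fderiv ℝ ((fun y => Real.log ‖s y‖) ∘ e.symm)) (e x) u (Complex.I • v) =
      2 * Real.pi * Ω x ![chartField e u x, chartField e v x] := by
  set ψ : E → ℝ := (fun y => Real.log ‖s y‖) ∘ e.symm with hψ
  have hψx : ContDiffAt ℝ ∞ ψ (e x) :=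
    contDiffAt_comp_chart_symm he hx (contMDiffAt_log_norm hL (hs.1 x) hsx)
  have hdψ : ContDiffAt ℝ ∞ (fderiv ℝ ψ) (e x) := hψx.fderiv_right (by simp)
  set H := fderiv ℝ (fderiv ℝ ψ) (e x) with hH
  -- `ρ` on a constant field, as a function on the chart
  let R : E → E → ℂ := fun w y => fderiv ℝ ψ y w - Complex.I * fderiv ℝ ψ y (Complex.I • w)
  have hev : ∀ w, HasFDerivAt (fun y => fderiv ℝ ψ y w)
      ((ContinuousLinearMap.apply ℝ ℝ w).comp H) (e x) := fun w =>
    (ContinuousLinearMap.apply ℝ ℝ w).hasFDerivAt.comp (e x)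
      (hdψ.differentiableAt (by simp)).hasFDerivAt
  have hR : ∀ w z, DifferentiableAt ℝ (R w) (e x) ∧ fderiv ℝ (R w) (e x) z =
      H z w - Complex.I * H z (Complex.I • w) := by
    intro w z
    have h1 := Complex.ofRealCLM.hasFDerivAt.comp (e x) (hev w)
    have h2 := (Complex.ofRealCLM.hasFDerivAt.comp (e x) (hev (Complex.I • w))).const_mul Complex.I
    have h3 : HasFDerivAt (R w) _ (e x) := h1.sub h2
    exact ⟨h3.differentiableAt, by rw [h3.fderiv]; rfl⟩
  have hRs : ∀ w, ContDiffAt ℝ ∞ (R w) (e x) := fun w =>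
    (Complex.ofRealCLM.contDiff.contDiffAt.comp _ (hdψ.clm_apply contDiffAt_const)).sub
      (contDiffAt_const.mul
        (Complex.ofRealCLM.contDiff.contDiffAt.comp _ (hdψ.clm_apply contDiffAt_const)))
  have hnear : ∀ w, ∀ᶠ y in 𝓝 x, cov s y (chartField e w y) = R w (e y) • s y := by
    intro w
    filter_upwards [e.open_source.mem_nhds hx, (isOpen_compl_zeroSet hs.1).mem_nhds hsx]
      with y hy hsy
    rw [cov_eq_rho_smul hsy, rho_chartField hL hcov hs he hy hsy]
  -- From `∇_w s = R_w s` near `x`, a second derivative gives `∇_z ∇_w s = (R_w R_z + dR_w(z)) s`.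
  -- The product is symmetric in `w, z` and drops out of the curvature.
  have hcovcov : ∀ w z, cov (fun y => cov s y (chartField e w y)) x (chartField e z x) =
      (R w (e x) * R z (e x) + (H z w - Complex.I * H z (Complex.I • w))) • s x := by
    intro w z
    have hg : ContMDiffAt 𝓘(ℝ, E) 𝓘(ℝ, ℂ) ∞ (fun y => R w (e y)) x :=
      (hRs w).contMDiffAt.comp x (contMDiffAt_of_mem_maximalAtlas (mem_maximalAtlas_real he) hx)
    rw [cov_congr ((hs.1 x).complex_smul hg) (hnear w),
      cov_complex_smul hcov (hg.mdifferentiableAt (by simp)) (hs.1 x),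
      mvfderiv_comp_chart he hx (hR w z).1, mvfderiv_pullbackField he hx, (hR w z).2,
      (hnear z).self_of_nhds, smul_smul, add_smul]
  have hcurv := hcov.curvature (chartField e u) (chartField e v) s x
    (smoothVectorFieldAt_pullbackField he hx contDiffAt_const)
    (smoothVectorFieldAt_pullbackField he hx contDiffAt_const) (hs.1 x)
  rw [hcovcov, hcovcov, mlieBracket_chartField he hx, map_zero, sub_zero, ← sub_smul] at hcurv
  -- Only the imaginary part carries information: the real part reduces to the symmetry of the
  -- Hessian `H`.
  have h := congrArg Complex.im (smul_left_injective ℂ hsx hcurv)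
  have hsymm : H u v = H v u := (hψx.isSymmSndFDerivAt (by simp; norm_cast)).eq u v
  simp [hsymm, mul_comm (R v (e x))] at h
  linarith

end Curvature

/-! ### The Kähler potential: `d(I dφ) = Ω` and plurisubharmonicity. -/

section Potential

variable {E : Type*} [NormedAddCommGroup E] [NormedSpace ℂ E] [FiniteDimensional ℂ E]
  {M : Type*} [TopologicalSpace M] [ChartedSpace E M] [IsManifold 𝓘(ℂ, E) ω M]
  {L : M → Type*} [∀ x, NormedAddCommGroup (L x)] [∀ x, InnerProductSpace ℂ (L x)]
  [TopologicalSpace (TotalSpace ℂ L)] [FiberBundle ℂ L] [VectorBundle ℂ ℂ L]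
  {Ω : Form E M 2} {cov : CovariantDerivative 𝓘(ℝ, E) ℂ L}

/-- The factor `-1/(2π)` in `φ` absorbs the `2π` of the curvature. The left side is `d(I dφ)` on two
constant fields, and also yields the Levi form when `u = iv`. -/
theorem hessian_potential (hL : IsSmoothHermitian E L) (hcov : IsPrequantumConnection Ω cov)
    {s : Π x : M, L x} (hs : IsHolomorphicSection cov s)
    {e : OpenPartialHomeomorph M E} (he : e ∈ IsManifold.maximalAtlas 𝓘(ℂ, E) ω M)
    {x : M} (hx : x ∈ e.source) (hsx : s x ≠ 0) (u v : E) :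
    fderiv ℝ (fderiv ℝ (potential s ∘ e.symm)) (e x) u (Complex.I • v) -
      fderiv ℝ (fderiv ℝ (potential s ∘ e.symm)) (e x) v (Complex.I • u) =
      Ω x ![chartField e u x, chartField e v x] := by
  have h := hessian_log_norm hL hcov hs he hx hsx u v
  set ψ : E → ℝ := (fun y => Real.log ‖s y‖) ∘ e.symm with hψ
  set c : ℝ := -(1 / (2 * Real.pi)) with hc
  have hψx : ContDiffAt ℝ ∞ ψ (e x) :=
    contDiffAt_comp_chart_symm he hx (contMDiffAt_log_norm hL (hs.1 x) hsx)
  have hdψ : DifferentiableAt ℝ (fderiv ℝ ψ) (e x) :=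
    (hψx.fderiv_right (m := 1) (by norm_cast)).differentiableAt (by simp)
  have e1 : potential s ∘ e.symm = c • ψ := rfl
  let A : (E →L[ℝ] ℝ) →L[ℝ] (E →L[ℝ] ℝ) := c • ContinuousLinearMap.id ℝ _
  have e2 : fderiv ℝ (c • ψ) = fun y => A (fderiv ℝ ψ y) := by
    rw [fderiv_const_smul_field]
    rfl
  have e3 : fderiv ℝ (fun y => A (fderiv ℝ ψ y)) (e x) = A.comp (fderiv ℝ (fderiv ℝ ψ) (e x)) :=
    (A.hasFDerivAt.comp (e x) hdψ.hasFDerivAt).fderiv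
  have e4 (w z : E) : A.comp (fderiv ℝ (fderiv ℝ ψ) (e x)) w z =
    c * fderiv ℝ (fderiv ℝ ψ) (e x) w z := rfl
  rw [e1, e2, e3, e4, e4, hc]
  rw [← mul_sub, ← neg_sub, h]
  field_simp

theorem isStrictlyPlurisubharmonicOn_potential (hΩ : IsKahlerForm Ω)
    (hL : IsSmoothHermitian E L) (hcov : IsPrequantumConnection Ω cov)
    {s : Π x : M, L x} (hs : IsHolomorphicSection cov s) :
    IsStrictlyPlurisubharmonicOn E (potential s) (zeroSet s)ᶜ := by
  refine ⟨(contMDiffOn_potential hL hs.1).of_le (by norm_cast), ?_⟩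
  rintro e he x ⟨hx, hsx⟩ v hv
  -- On the pair `(iv, v)` the second term becomes `-φ''(v, i·iv) = φ''(v, v)`, so the left side is
  -- four times the Levi form.
  have h := hessian_potential hL hcov hs he hx hsx (Complex.I • v) v
  have hpos := hΩ.pos x _ (chartField_ne_zero he hx hv)
  rw [chartField_I_smul he hx, smul_smul, Complex.I_mul_I, neg_one_smul, map_neg,
    sub_neg_eq_add] at h
  rw [leviForm]
  linarith

theorem eventually_nhds_symm {e : OpenPartialHomeomorph M E} {x : M} (hx : x ∈ e.source)
    {p : M → Prop} (hp : ∀ᶠ y in 𝓝 x, p y) :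
    ∀ᶠ y in 𝓝 (e x), y ∈ e.target ∧ p (e.symm y) := by
  refine Filter.Eventually.and (e.open_target.mem_nhds (e.map_source hx)) ?_
  have := e.continuousAt_symm (e.map_source hx)
  rw [ContinuousAt, e.left_inv hx] at this
  exact this.eventually hp

theorem chartAt_mem_maximalAtlas (x : M) :
    chartAt E x ∈ IsManifold.maximalAtlas 𝓘(ℂ, E) ω M :=
  IsManifold.chart_mem_maximalAtlas x

theorem mfderiv_chart_symm {e : OpenPartialHomeomorph M E}
    (he : e ∈ IsManifold.maximalAtlas 𝓘(ℂ, E) ω M) {y : E} (hy : y ∈ e.target) (u : E) :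
    mfderiv 𝓘(ℝ, E) 𝓘(ℝ, E) e.symm y u = chartField e u (e.symm y) := by
  have hsrc := e.map_target hy
  apply mvfderiv_chart_injective he hsrc
  rw [mvfderiv_pullbackField he hsrc]
  have hd := mdifferentiable_of_mem_maximalAtlas he
  exact congrArg (fun A : E →L[ℝ] E => A u) (hd.comp_symm_deriv hy)

theorem inChart_oneForm_complexStructureForm {f : M → ℝ} (x : M) {y : E}
    (hy : y ∈ (chartAt E x).target)
    (hf : ContMDiffAt 𝓘(ℝ, E) 𝓘(ℝ) ∞ f ((chartAt E x).symm y)) :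
    (oneForm (complexStructureForm (mvfderiv 𝓘(ℝ, E) f))).inChart x y =
      ContinuousAlternatingMap.ofSubsingleton ℝ E ℝ (0 : Fin 1)
        ((fderiv ℝ (f ∘ (chartAt E x).symm) y).comp
          (Complex.I • ContinuousLinearMap.id ℝ E : E →L[ℝ] E)) := by
  ext v
  have he := chartAt_mem_maximalAtlas (E := E) x
  have hsrc := (chartAt E x).map_target hy
  change mvfderiv 𝓘(ℝ, E) f ((chartAt E x).symm y) (complexStructure _
    (mfderiv 𝓘(ℝ, E) 𝓘(ℝ, E) (chartAt E x).symm y (v 0))) =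
      fderiv ℝ (f ∘ (chartAt E x).symm) y (Complex.I • v 0)
  rw [mfderiv_chart_symm he hy, ← chartField_I_smul he hsrc,
    mvfderiv_eq_fderiv_chart he hsrc hf, mvfderiv_pullbackField he hsrc,
    (chartAt E x).right_inv hy]

theorem d_complexStructureForm_potential (hL : IsSmoothHermitian E L)
    (hcov : IsPrequantumConnection Ω cov)
    {s : Π x : M, L x} (hs : IsHolomorphicSection cov s) {x : M} (hsx : s x ≠ 0) :
    (oneForm (complexStructureForm (mvfderiv 𝓘(ℝ, E) (potential s)))).d x = Ω x := by
  have he := chartAt_mem_maximalAtlas (E := E) x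
  have hx := mem_chart_source E x
  have hopen := isOpen_compl_zeroSet hs.1
  set φ : E → ℝ := potential s ∘ (chartAt E x).symm with hφ
  have hφx : ContDiffAt ℝ ∞ φ (chartAt E x x) := contDiffAt_comp_chart_symm he hx
    ((contMDiffOn_potential hL hs.1).contMDiffAt (hopen.mem_nhds hsx))
  have hdφ : DifferentiableAt ℝ (fderiv ℝ φ) (chartAt E x x) :=
    (hφx.fderiv_right (m := 1) (by norm_cast)).differentiableAt (by simp)
  let J : E →L[ℝ] E := Complex.I • ContinuousLinearMap.id ℝ E
  let η : E → E [⋀^Fin 1]→L[ℝ] ℝ := fun y =>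
    ContinuousAlternatingMap.ofSubsingleton ℝ E ℝ (0 : Fin 1) ((fderiv ℝ φ y).comp J)
  -- The coordinate formula `η` needs `φ` smooth, so it holds only off the zero set; the exterior
  -- derivative depends only on the germ.
  have hev : (oneForm (complexStructureForm (mvfderiv 𝓘(ℝ, E) (potential s)))).inChart x
      =ᶠ[𝓝 (chartAt E x x)] η := by
    filter_upwards [eventually_nhds_symm hx (hopen.mem_nhds hsx)] with y hy
    exact inChart_oneForm_complexStructureForm x hy.1
      ((contMDiffOn_potential hL hs.1).contMDiffAt (hopen.mem_nhds hy.2))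
  have hη : DifferentiableAt ℝ η (chartAt E x x) :=
    (ContinuousAlternatingMap.ofSubsingletonLIE (𝕜 := ℝ) (E := E) (F := ℝ)
      (0 : Fin 1)).toContinuousLinearEquiv.differentiableAt.comp _
      (hdφ.clm_comp (differentiableAt_const J))
  have key : ∀ u v : E, extDeriv ((oneForm (complexStructureForm
      (mvfderiv 𝓘(ℝ, E) (potential s)))).inChart x) (chartAt E x x) ![u, v] =
        Ω x ![chartField (chartAt E x) u x, chartField (chartAt E x) v x] := by
    intro u v
    have hd : ∀ w z : E, fderiv ℝ (fun y => fderiv ℝ φ y (J w)) (chartAt E x x) z =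
        fderiv ℝ (fderiv ℝ φ) (chartAt E x x) z (J w) := fun w z => by
      have := (ContinuousLinearMap.apply ℝ ℝ (J w)).hasFDerivAt.comp (chartAt E x x)
        hdφ.hasFDerivAt
      exact congrArg (fun A => A z) this.fderiv
    -- For a one-form the alternating sum has two terms: removing the entry `u` leaves `v`, with
    -- sign plus, and removing `v` leaves `u`, with sign minus.
    rw [hev.extDeriv.self_of_nhds, extDeriv_apply hη, Fin.sum_univ_two]
    have h0 : (fun y => η y ((0 : Fin 2).removeNth ![u, v])) = fun y => fderiv ℝ φ y (J v) := rfl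
    have h1 : (fun y => η y ((1 : Fin 2).removeNth ![u, v])) = fun y => fderiv ℝ φ y (J u) := rfl
    rw [h0, h1, hd, hd, ← hessian_potential hL hcov hs he hx hsx u v]
    simp [J, φ, sub_eq_add_neg]
  ext w
  have hw : ∀ u : TangentSpace 𝓘(ℝ, E) x, u =
      chartField (chartAt E x) (mvfderiv 𝓘(ℝ, E) (chartAt E x) x u) x := eq_chartField he hx
  have hw2 : w = ![w 0, w 1] := by ext i; fin_cases i <;> rfl
  have hlhs : (oneForm (complexStructureForm (mvfderiv 𝓘(ℝ, E) (potential s)))).d x w =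
      extDeriv ((oneForm (complexStructureForm
        (mvfderiv 𝓘(ℝ, E) (potential s)))).inChart x) (chartAt E x x)
        ![mvfderiv 𝓘(ℝ, E) (chartAt E x) x (w 0), mvfderiv 𝓘(ℝ, E) (chartAt E x) x (w 1)] := by
    refine congrArg (extDeriv ((oneForm (complexStructureForm
        (mvfderiv 𝓘(ℝ, E) (potential s)))).inChart x) (chartAt E x x)) ?_
    ext i; fin_cases i <;> rfl
  rw [hlhs, key, ← hw, ← hw, ← hw2]

end Potential

/-! ### The pulled-back connection, and special Bohr–Sommerfeld as vanishing of `Im ρ_s` on `S`. -/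

section Restriction

variable {E : Type*} [NormedAddCommGroup E] [NormedSpace ℂ E]
  {M : Type*} [TopologicalSpace M] [ChartedSpace E M] [IsManifold 𝓘(ℂ, E) ω M]
  {L : M → Type*} [∀ x, NormedAddCommGroup (L x)] [∀ x, InnerProductSpace ℂ (L x)]
  [TopologicalSpace (TotalSpace ℂ L)] [FiberBundle ℂ L] [VectorBundle ℂ ℂ L]
  {Ω : Form E M 2} {cov : CovariantDerivative 𝓘(ℝ, E) ℂ L}
  {F : Type*} [NormedAddCommGroup F] [NormedSpace ℝ F]
  {S : Type*} [TopologicalSpace S] [ChartedSpace F S] {ι : S → M}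

theorem mvfderiv_comp_mfderiv {G : Type*} [NormedAddCommGroup G] [NormedSpace ℝ G] {g : M → G}
    {p : S} (hg : MDifferentiableAt 𝓘(ℝ, E) 𝓘(ℝ, G) g (ι p))
    (hι : MDifferentiableAt 𝓘(ℝ, F) 𝓘(ℝ, E) ι p) (v : TangentSpace 𝓘(ℝ, F) p) :
    mvfderiv 𝓘(ℝ, F) (fun q => g (ι q)) p v =
      mvfderiv 𝓘(ℝ, E) g (ι p) (mfderiv 𝓘(ℝ, F) 𝓘(ℝ, E) ι p v) :=
  mfderiv_comp_apply p hg hι v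

theorem mvfderiv_congr {G : Type*} [NormedAddCommGroup G] [NormedSpace ℝ G] {f g : S → G} {p : S}
    (h : f =ᶠ[𝓝 p] g) (v : TangentSpace 𝓘(ℝ, F) p) :
    mvfderiv 𝓘(ℝ, F) f p v = mvfderiv 𝓘(ℝ, F) g p v := by
  rw [mvfderiv_eq_mfderiv, mvfderiv_eq_mfderiv, h.mfderiv_eq]
  rfl

/-- The pulled-back connection on the restriction of a section of `L`. -/
theorem restrictedConnection_comp (hcov : IsPrequantumConnection Ω cov) {s : Π x : M, L x} {p : S}
    (hs : SmoothSectionAt E s (ι p)) (hι : MDifferentiableAt 𝓘(ℝ, F) 𝓘(ℝ, E) ι p)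
    (v : TangentSpace 𝓘(ℝ, F) p) :
    restrictedConnection cov ι (fun q => s (ι q)) p v =
      cov s (ι p) (mfderiv 𝓘(ℝ, F) 𝓘(ℝ, E) ι p v) := by
  have hg := smoothSectionAt_iff.1 hs
  have hd : MDifferentiableAt 𝓘(ℝ, E) 𝓘(ℝ, ℂ) (fun y => fiberCoord (ι p) (s y)) (ι p) :=
    hg.mdifferentiableAt (by simp)
  have hframe := smoothSectionAt_localFrame (E := E) (L := L) (ι p)
  have h1 : ∀ᶠ y in 𝓝 (ι p), s y = fiberCoord (ι p) (s y) • localFrame L (ι p) y := by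
    filter_upwards [mem_baseSet_nhds (L := L) (ι p)] with y hy
    exact (fiberCoord_smul_localFrame hy (s y)).symm
  have h2 : frameComponent ι (fun q => s (ι q)) (ι p) = fun q => fiberCoord (ι p) (s (ι q)) := rfl
  rw [cov_congr (hframe.complex_smul hg) h1, cov_complex_smul hcov hd hframe,
    restrictedConnection, h2, mvfderiv_comp_mfderiv hd hι, add_comm]

theorem restrictedConnection_smul {σ : Π p : S, L (ι p)} {h : S → ℂ} {p : S}
    (hι : ContinuousAt ι p) (hh : MDifferentiableAt 𝓘(ℝ, F) 𝓘(ℝ, ℂ) h p)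
    (hσ : MDifferentiableAt 𝓘(ℝ, F) 𝓘(ℝ, ℂ) (frameComponent ι σ (ι p)) p)
    (v : TangentSpace 𝓘(ℝ, F) p) :
    restrictedConnection cov ι (fun q => h q • σ q) p v =
      mvfderiv 𝓘(ℝ, F) h p v • σ p + h p • restrictedConnection cov ι σ p v := by
  have h1 : frameComponent ι (fun q => h q • σ q) (ι p) =ᶠ[𝓝 p]
      fun q => h q * frameComponent ι σ (ι p) q := by
    filter_upwards [hι (mem_baseSet_nhds (L := L) (ι p))] with q hq
    exact fiberCoord_smul hq _ _
  have h2 : frameComponent ι σ (ι p) p • localFrame L (ι p) (ι p) = σ p :=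
    fiberCoord_smul_localFrame (FiberBundle.mem_baseSet_trivializationAt ℂ L (ι p)) (σ p)
  rw [restrictedConnection, restrictedConnection, mvfderiv_congr h1, mvfderiv_complex_mul hh hσ,
    h1.self_of_nhds]
  conv_rhs => rw [← h2]
  simp only [add_smul, mul_smul, smul_add]
  rw [smul_comm (frameComponent ι σ (ι p) p) (mvfderiv 𝓘(ℝ, F) h p v)]
  abel

theorem contMDiffAt_frameComponent {σ : Π p : S, L (ι p)}
    (hσ : ContMDiff 𝓘(ℝ, F) (𝓘(ℝ, E).prod 𝓘(ℝ, ℂ)) ∞ (fun p => TotalSpace.mk' ℂ (ι p) (σ p)))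
    (p : S) : ContMDiffAt 𝓘(ℝ, F) 𝓘(ℝ, ℂ) ∞ (frameComponent ι σ (ι p)) p :=
  (contMDiffAt_totalSpace.1 (hσ p)).2

theorem contMDiff_section_comp (hι : ContMDiff 𝓘(ℝ, F) 𝓘(ℝ, E) ∞ ι) {s : Π x : M, L x}
    (hs : ∀ x, SmoothSectionAt E s x) :
    ContMDiff 𝓘(ℝ, F) (𝓘(ℝ, E).prod 𝓘(ℝ, ℂ)) ∞
      (fun p => TotalSpace.mk' ℂ (ι p) (s (ι p))) :=
  fun p => ContMDiffAt.comp p (hs (ι p)) (hι p)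

theorem contMDiff_section_smul {σ : Π p : S, L (ι p)} {h : S → ℂ}
    (hσ : ContMDiff 𝓘(ℝ, F) (𝓘(ℝ, E).prod 𝓘(ℝ, ℂ)) ∞ (fun p => TotalSpace.mk' ℂ (ι p) (σ p)))
    (hh : ContMDiff 𝓘(ℝ, F) 𝓘(ℝ, ℂ) ∞ h) :
    ContMDiff 𝓘(ℝ, F) (𝓘(ℝ, E).prod 𝓘(ℝ, ℂ)) ∞
      (fun p => TotalSpace.mk' ℂ (ι p) (h p • σ p)) := by
  intro p
  obtain ⟨h1, h2⟩ := contMDiffAt_totalSpace.1 (hσ p)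
  refine contMDiffAt_totalSpace.2 ⟨h1, (contMDiffAt_complex_mul (hh p) h2).congr_of_eventuallyEq ?_⟩
  filter_upwards [h1.continuousAt (mem_baseSet_nhds (L := L) (ι p))] with q hq
  exact fiberCoord_smul hq _ _

/-- The parallel section is `s/|s|`, with `c = 0` and `f = |s|`: normalizing removes `Re ρ = d
ln|s|` from `∇s = ρ s`, and what remains is `i Im ρ`. -/
theorem isSpecialBohrSommerfeld_of_imRho_eq_zero (hL : IsSmoothHermitian E L)
    (hcov : IsPrequantumConnection Ω cov) {s : Π x : M, L x}
    (hs : ∀ x, SmoothSectionAt E s x) (hι : ContMDiff 𝓘(ℝ, F) 𝓘(ℝ, E) ∞ ι)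
    (hne : ∀ p, s (ι p) ≠ 0)
    (him : ∀ p (v : TangentSpace 𝓘(ℝ, F) p),
      imRho cov s (ι p) (mfderiv 𝓘(ℝ, F) 𝓘(ℝ, E) ι p v) = 0) :
    IsSpecialBohrSommerfeld F cov s ι := by
  -- This is `1/|s|`, written through `ln|s|` because the smoothness and differential of that
  -- function are known.
  let h : S → ℂ := fun q => (Real.exp (-Real.log ‖s (ι q)‖) : ℝ)
  have hlog : ContMDiff 𝓘(ℝ, F) 𝓘(ℝ) ∞ (fun q => Real.log ‖s (ι q)‖) := fun q =>
    (contMDiffAt_log_norm hL (hs (ι q)) (hne q)).comp q (hι q)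
  have hexp : ContDiff ℝ ∞ (fun t : ℝ => ((Real.exp (-t) : ℝ) : ℂ)) :=
    Complex.ofRealCLM.contDiff.comp (Real.contDiff_exp.comp contDiff_neg)
  have hh : ContMDiff 𝓘(ℝ, F) 𝓘(ℝ, ℂ) ∞ h := hexp.contMDiff.comp hlog
  have hsec := contMDiff_section_comp hι hs
  have hid : ∀ p, MDifferentiableAt 𝓘(ℝ, F) 𝓘(ℝ, E) ι p := fun p =>
    (hι p).mdifferentiableAt (by simp)
  refine ⟨hne, fun q => h q • s (ι q), ⟨contMDiff_section_smul hsec hh, fun q => ?_, ?_⟩, 0,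
    fun q => ‖s (ι q)‖, fun q => norm_pos_iff.2 (hne q), fun q => ?_⟩
  · exact smul_ne_zero (Complex.ofReal_ne_zero.2 (Real.exp_pos _).ne') (hne q)
  · intro p v
    have hdh : mvfderiv 𝓘(ℝ, F) h p v =
        -h p * (rho cov s (ι p) (mfderiv 𝓘(ℝ, F) 𝓘(ℝ, E) ι p v)).re := by
      have hA : HasDerivAt (fun t : ℝ => ((Real.exp (-t) : ℝ) : ℂ))
          ((-Real.exp (-Real.log ‖s (ι p)‖) : ℝ) : ℂ) (Real.log ‖s (ι p)‖) := by
        have := ((hasDerivAt_neg (Real.log ‖s (ι p)‖)).exp).ofReal_comp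
        simpa using this
      have := mvfderiv_comp_of_hasFDerivAt (g := fun q => Real.log ‖s (ι q)‖) hA.hasFDerivAt
        ((hlog p).mdifferentiableAt (by simp)) v
      rw [mvfderiv_comp_mfderiv (g := fun y => Real.log ‖s y‖)
        ((contMDiffAt_log_norm hL (hs (ι p)) (hne p)).mdifferentiableAt (by simp)) (hid p),
        ← re_rho hL hcov (hs (ι p)) (hne p)] at this
      refine this.trans ?_
      simp [h, mul_comm]
    have hi : (rho cov s (ι p) (mfderiv 𝓘(ℝ, F) 𝓘(ℝ, E) ι p v)).im = 0 := him p v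
    rw [restrictedConnection_smul (hι p).continuousAt ((hh p).mdifferentiableAt (by simp))
      ((contMDiffAt_frameComponent hsec p).mdifferentiableAt (by simp)),
      restrictedConnection_comp hcov (hs (ι p)) (hid p), cov_eq_rho_smul (hne p), hdh, smul_smul,
      ← add_smul]
    conv_lhs => rw [← Complex.re_add_im (rho cov s (ι p) (mfderiv 𝓘(ℝ, F) 𝓘(ℝ, E) ι p v)), hi]
    simp
  · have : ((‖s (ι q)‖ : ℂ) * Complex.exp (Complex.I * (0 : ℝ))) * h q = 1 := by
      have h0 := norm_pos_iff.2 (hne q)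
      simp only [h, Real.exp_neg, Real.exp_log h0, Complex.ofReal_zero, mul_zero, Complex.exp_zero,
        mul_one]
      rw [← Complex.ofReal_mul, mul_inv_cancel₀ h0.ne', Complex.ofReal_one]
    rw [smul_smul, this, one_smul]

theorem imRho_eq_zero_of_isSpecialBohrSommerfeld
    (hcov : IsPrequantumConnection Ω cov) {s : Π x : M, L x}
    (hs : ∀ x, SmoothSectionAt E s x) (hι : ContMDiff 𝓘(ℝ, F) 𝓘(ℝ, E) ∞ ι)
    (h : IsSpecialBohrSommerfeld F cov s ι) (p : S) (v : TangentSpace 𝓘(ℝ, F) p) :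
    imRho cov s (ι p) (mfderiv 𝓘(ℝ, F) 𝓘(ℝ, E) ι p v) = 0 := by
  obtain ⟨hne, σ, hσ, c, f, hf, hsσ⟩ := h
  have hid := (hι p).mdifferentiableAt (by simp)
  let k : S → ℂ := fun q => f q * Complex.exp (Complex.I * c)
  have hbase := FiberBundle.mem_baseSet_trivializationAt ℂ L (ι p)
  have ha := contMDiffAt_frameComponent (contMDiff_section_comp hι hs) p
  have hb := contMDiffAt_frameComponent hσ.smooth p
  have hb0 : frameComponent ι σ (ι p) p ≠ 0 := mt (fiberCoord_eq_zero hbase).1 (hσ.ne_zero p)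
  -- The function `f` is not assumed smooth. Its differentiability comes from `k` being locally the
  -- quotient of the frame components of `s` and `σ`.
  have hk : k =ᶠ[𝓝 p] fun q =>
      frameComponent ι (fun q => s (ι q)) (ι p) q / frameComponent ι σ (ι p) q := by
    filter_upwards [hid.continuousAt (mem_baseSet_nhds (L := L) (ι p)),
      hb.continuousAt.eventually_ne hb0] with q hq hq0
    rw [eq_div_iff hq0]
    have : fiberCoord (ι p) (s (ι q)) = k q * fiberCoord (ι p) (σ q) := by
      rw [hsσ q, fiberCoord_smul hq]
    exact this.symm
  have hkd : MDifferentiableAt 𝓘(ℝ, F) 𝓘(ℝ, ℂ) k p := by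
    have hdiv : ContDiffAt ℝ ∞ (fun z : ℂ × ℂ => z.1 * z.2⁻¹)
        (frameComponent ι (fun q => s (ι q)) (ι p) p, frameComponent ι σ (ι p) p) :=
      contDiffAt_fst.mul (contDiffAt_snd.inv hb0)
    have := (hdiv.contMDiffAt.comp p (ha.prodMk_space hb)).congr_of_eventuallyEq hk
    exact this.mdifferentiableAt (by simp)
  have e1 : cov s (ι p) (mfderiv 𝓘(ℝ, F) 𝓘(ℝ, E) ι p v) = mvfderiv 𝓘(ℝ, F) k p v • σ p := by
    rw [← restrictedConnection_comp hcov (hs (ι p)) hid,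
      show (fun q => s (ι q)) = fun q => k q • σ q from funext hsσ,
      restrictedConnection_smul hid.continuousAt hkd (hb.mdifferentiableAt (by simp)),
      hσ.parallel, smul_zero, add_zero]
  rw [cov_eq_rho_smul (hne p), hsσ p, smul_smul] at e1
  have e2 := smul_left_injective ℂ (hσ.ne_zero p) e1
  have hE : Complex.exp (Complex.I * c) ≠ 0 := Complex.exp_ne_zero _
  -- Rotating back by `e^{-ic}` makes `k` real, so `A ∘ k` vanishes identically, whereas `A (dk(v))
  -- = f · Im ρ(v)` because `dk = ρ k`.
  let A : ℂ →L[ℝ] ℝ := Complex.imCLM ∘L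
    ((ContinuousLinearMap.mul ℝ ℂ) (Complex.exp (Complex.I * c))⁻¹)
  have e3 := mvfderiv_comp_of_hasFDerivAt (g := k) A.hasFDerivAt hkd v
  have e4 : (fun q => A (k q)) = fun _ => 0 := by
    funext q
    have : A (k q) = ((Complex.exp (Complex.I * c))⁻¹ * (f q * Complex.exp (Complex.I * c))).im :=
      rfl
    rw [this, mul_comm (f q : ℂ), inv_mul_cancel_left₀ hE, Complex.ofReal_im]
  rw [e4, mvfderiv_const, zero_apply] at e3
  have e5 : A (mvfderiv 𝓘(ℝ, F) k p v) =
      (f p * rho cov s (ι p) (mfderiv 𝓘(ℝ, F) 𝓘(ℝ, E) ι p v)).im := by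
    rw [← e2]
    change ((Complex.exp (Complex.I * c))⁻¹ * (rho cov s (ι p) (mfderiv 𝓘(ℝ, F) 𝓘(ℝ, E) ι p v) *
      (f p * Complex.exp (Complex.I * c)))).im = _
    congr 1
    field_simp
  rw [e5, Complex.im_ofReal_mul] at e3
  exact (mul_eq_zero.1 e3.symm).resolve_left (hf p).ne'

end Restriction

/-! ### Linear algebra of two-forms. -/

/-- The continuous bilinear form `(u, v) ↦ α(u, v)` associated with an alternating `2`-form `α`. -/
def curryTwoForm (E : Type*) [NormedAddCommGroup E] [NormedSpace ℝ E] :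
    (E [⋀^Fin 2]→L[ℝ] ℝ) →L[ℝ] E →L[ℝ] E →L[ℝ] ℝ :=
  (ContinuousLinearMap.compL ℝ E (E [⋀^Fin 1]→L[ℝ] ℝ) (E →L[ℝ] ℝ)
    ((ContinuousAlternatingMap.ofSubsingletonLIE (𝕜 := ℝ) (E := E) (F := ℝ)
      (0 : Fin 1)).symm.toContinuousLinearEquiv : (E [⋀^Fin 1]→L[ℝ] ℝ) →L[ℝ] E →L[ℝ] ℝ)) ∘L
  (ContinuousAlternatingMap.curryLeftLI.toContinuousLinearMap :
    (E [⋀^Fin 2]→L[ℝ] ℝ) →L[ℝ] E →L[ℝ] E [⋀^Fin 1]→L[ℝ] ℝ)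

theorem curryTwoForm_apply {E : Type*} [NormedAddCommGroup E] [NormedSpace ℝ E]
    (α : E [⋀^Fin 2]→L[ℝ] ℝ) (u v : E) : curryTwoForm E α u v = α ![u, v] := by
  have : curryTwoForm E α u v = α (Matrix.vecCons u fun _ => v) := rfl
  rw [this]
  congr 1
  ext i; fin_cases i <;> rfl

theorem curryTwoForm_swap {E : Type*} [NormedAddCommGroup E] [NormedSpace ℝ E]
    (α : E [⋀^Fin 2]→L[ℝ] ℝ) (u v : E) : curryTwoForm E α u v = -curryTwoForm E α v u := by
  rw [curryTwoForm_apply, curryTwoForm_apply]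
  refine Eq.trans ?_ (α.toAlternatingMap.map_swap ![v, u] (i := 0) (j := 1) (by simp))
  refine congrArg α ?_
  ext i; fin_cases i <;> rfl

/-- Isotropy is one inclusion, and nondegeneracy gives both sides the same dimension. -/
theorem eq_orthogonal_of_isotropic {V : Type*} [AddCommGroup V] [Module ℝ V]
    [FiniteDimensional ℝ V] {B : LinearMap.BilinForm ℝ V} (hB : B.Nondegenerate)
    {W : Submodule ℝ V} (hW : Module.finrank ℝ V = 2 * Module.finrank ℝ W)
    (hiso : ∀ u ∈ W, ∀ v ∈ W, B u v = 0) : W = B.orthogonal W := by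
  refine Submodule.eq_of_le_of_finrank_eq (fun v hv u hu => hiso u hu v hv) ?_
  rw [LinearMap.BilinForm.finrank_orthogonal hB]
  omega

/-! ### Local left inverses of immersions. -/

section LeftInverse

variable {E : Type*} [NormedAddCommGroup E] [NormedSpace ℝ E]
  {M : Type*} [TopologicalSpace M] [ChartedSpace E M]
  {F : Type*} [NormedAddCommGroup F] [NormedSpace ℝ F]
  {S : Type*} [TopologicalSpace S] [ChartedSpace F S] {ι : S → M} {p : S}

/-- An immersion has smooth local left inverses. -/
theorem exists_leftInverse_of_isImmersionAt
    (h : Manifold.IsImmersionAt 𝓘(ℝ, F) 𝓘(ℝ, E) ∞ ι p) :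
    ∃ r : M → S, ContMDiffAt 𝓘(ℝ, E) 𝓘(ℝ, F) ∞ r (ι p) ∧ ∀ᶠ q in 𝓝 p, r (ι q) = q := by
  -- In the charts adapted to the immersion, `ι` reads `u ↦ (u, 0)`, and `A` is the projection back
  -- to `u`.
  let A : E →L[ℝ] F := ContinuousLinearMap.fst ℝ F h.complement ∘L
    (h.equiv.symm : E →L[ℝ] F × h.complement)
  have hA : ∀ q ∈ h.domChart.source, A (h.codChart (ι q)) = h.domChart q := by
    intro q hq
    have hm : h.domChart q ∈ (h.domChart.extend 𝓘(ℝ, F)).target := by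
      rw [OpenPartialHomeomorph.extend_target_eq_image_source]
      exact ⟨q, hq, rfl⟩
    have h1 := h.writtenInCharts hm
    have h2 : h.codChart (ι q) = h.equiv (h.domChart q, 0) := by
      simpa [h.domChart.left_inv hq] using h1
    rw [h2]
    simp [A]
  refine ⟨fun x => h.domChart.symm (A (h.codChart x)), ?_, ?_⟩
  · have h1 := contMDiffAt_of_mem_maximalAtlas h.codChart_mem_maximalAtlas h.mem_codChart_source
    have h2 : ContMDiffAt 𝓘(ℝ, E) 𝓘(ℝ, F) ∞ (fun x => A (h.codChart x)) (ι p) :=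
      A.contMDiff.contMDiffAt.comp (ι p) h1
    have h3 := contMDiffAt_symm_of_mem_maximalAtlas (x := A (h.codChart (ι p)))
      h.domChart_mem_maximalAtlas
      (by rw [hA p h.mem_domChart_source]; exact h.domChart.map_source h.mem_domChart_source)
    exact h3.comp (ι p) h2
  · filter_upwards [h.domChart.open_source.mem_nhds h.mem_domChart_source] with q hq
    simp only [hA q hq, h.domChart.left_inv hq]

theorem mfderiv_leftInverse {r : M → S} (hr : MDifferentiableAt 𝓘(ℝ, E) 𝓘(ℝ, F) r (ι p))
    (hι : MDifferentiableAt 𝓘(ℝ, F) 𝓘(ℝ, E) ι p) (h : ∀ᶠ q in 𝓝 p, r (ι q) = q)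
    (v : TangentSpace 𝓘(ℝ, F) p) :
    (mfderiv 𝓘(ℝ, E) 𝓘(ℝ, F) r (ι p) (mfderiv 𝓘(ℝ, F) 𝓘(ℝ, E) ι p v) : F) = v := by
  have h1 : HasMFDerivAt 𝓘(ℝ, F) 𝓘(ℝ, F) (r ∘ ι) p
      (ContinuousLinearMap.id ℝ (TangentSpace 𝓘(ℝ, F) p)) :=
    (hasMFDerivAt_id p).congr_of_eventuallyEq h
  have h2 := hasMFDerivAt_unique h1 (hr.hasMFDerivAt.comp p hι.hasMFDerivAt)
  exact (congrArg (fun A : F →L[ℝ] F => A v) h2).symm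

theorem mfderiv_injective_of_isImmersionAt
    (h : Manifold.IsImmersionAt 𝓘(ℝ, F) 𝓘(ℝ, E) ∞ ι p) :
    Function.Injective (mfderiv 𝓘(ℝ, F) 𝓘(ℝ, E) ι p) := by
  obtain ⟨r, hr, hl⟩ := exists_leftInverse_of_isImmersionAt h
  have hr' := hr.mdifferentiableAt (by simp)
  have hι := h.contMDiffAt.mdifferentiableAt (by simp)
  intro v w hvw
  rw [← mfderiv_leftInverse hr' hι hl v, hvw, mfderiv_leftInverse hr' hι hl w]

end LeftInverse

/-! ### Tangency of the gradient to a Lagrangian submanifold. -/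

section Lagrangian

variable {E : Type*} [NormedAddCommGroup E] [NormedSpace ℂ E] [FiniteDimensional ℂ E]
  {M : Type*} [TopologicalSpace M] [ChartedSpace E M] [IsManifold 𝓘(ℂ, E) ω M]
  {L : M → Type*} [∀ x, NormedAddCommGroup (L x)] [∀ x, InnerProductSpace ℂ (L x)]
  [TopologicalSpace (TotalSpace ℂ L)] [FiberBundle ℂ L] [VectorBundle ℂ ℂ L]
  {Ω : Form E M 2} {cov : CovariantDerivative 𝓘(ℝ, E) ℂ L}
  {F : Type*} [NormedAddCommGroup F] [NormedSpace ℝ F]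
  {S : Type*} [TopologicalSpace S] [ChartedSpace F S] {ι : S → M}

/-- The value of a `2`-form on `M` at a point, as a bilinear form on the model space. -/
def Form.bilin (Ω : Form E M 2) (x : M) : LinearMap.BilinForm ℝ E :=
  (curryTwoForm E (show E [⋀^Fin 2]→L[ℝ] ℝ from Ω x)).toLinearMap₁₂

theorem Form.bilin_apply (Ω : Form E M 2) (x : M) (u v : TangentSpace 𝓘(ℝ, E) x) :
    Ω.bilin x u v = Ω x ![u, v] :=
  curryTwoForm_apply (show E [⋀^Fin 2]→L[ℝ] ℝ from Ω x) u v

theorem Form.bilin_swap (Ω : Form E M 2) (x : M) (u v : E) :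
    Ω.bilin x u v = -Ω.bilin x v u :=
  curryTwoForm_swap (show E [⋀^Fin 2]→L[ℝ] ℝ from Ω x) u v

/-- A nonzero `u` is detected by `Iu`, since `Ω(Iu, u) > 0`. -/
theorem IsKahlerForm.nondegenerate (hΩ : IsKahlerForm Ω) (x : M) : (Ω.bilin x).Nondegenerate := by
  have h : ∀ u : E, u ≠ 0 → Ω.bilin x u (Complex.I • u) ≠ 0 ∧ Ω.bilin x (Complex.I • u) u ≠ 0 := by
    intro u hu
    have h1 := hΩ.pos x u hu
    have h2 : Ω.bilin x (Complex.I • u) u = Ω x ![complexStructure x u, u] :=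
      Ω.bilin_apply x (complexStructure x u) u
    rw [Ω.bilin_swap x u, neg_ne_zero, and_self, h2]
    exact h1.ne'
  refine ⟨fun u hu => ?_, fun u hu => ?_⟩
  · by_contra hne
    exact (h u hne).1 (hu _)
  · by_contra hne
    exact (h u hne).2 (hu _)

/-- The gradient is characterized by its defining property. -/
theorem eq_gradient (hΩ : IsKahlerForm Ω) {f : M → ℝ} {x : M} {w : TangentSpace 𝓘(ℝ, E) x}
    (hw : ∀ v, kahlerMetric Ω x w v = mvfderiv 𝓘(ℝ, E) f x v) : gradient Ω f x = w := by
  have h : ∀ v : E, Ω.bilin x (Complex.I • (show E from gradient Ω f x)) v =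
      Ω.bilin x (Complex.I • (show E from w)) v := fun v =>
    (Ω.bilin_apply x (complexStructure x (gradient Ω f x)) v).trans <|
      (kahlerMetric_gradient hΩ f x v).trans <|
        (hw v).symm.trans (Ω.bilin_apply x (complexStructure x w) v).symm
  have h1 : Complex.I • (show E from gradient Ω f x) - Complex.I • (show E from w) = 0 := by
    refine (hΩ.nondegenerate x).1 _ fun v => ?_
    rw [map_sub, LinearMap.sub_apply, h, sub_self]
  exact smul_right_injective E Complex.I_ne_zero (sub_eq_zero.1 h1)

/-- Here `Im ρ(v) = 2π dφ(Iv) = 2π Ω(I grad φ, Iv)`, and invariance of `Ω` removes `I` from both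
arguments. -/
theorem imRho_eq_gradient (hΩ : IsKahlerForm Ω) (hL : IsSmoothHermitian E L)
    (hcov : IsPrequantumConnection Ω cov) {s : Π x : M, L x} (hs : IsHolomorphicSection cov s)
    {x : M} (hx : s x ≠ 0) (v : TangentSpace 𝓘(ℝ, E) x) :
    imRho cov s x v = 2 * Real.pi * Ω x ![gradient Ω (potential s) x, v] := by
  have h1 := mvfderiv_comp_of_hasFDerivAt (g := fun y => Real.log ‖s y‖)
    (((ContinuousLinearMap.id ℝ ℝ).hasFDerivAt (x := Real.log ‖s x‖)).const_mul
      (-(1 / (2 * Real.pi)))) ((contMDiffAt_log_norm hL (hs.1 x) hx).mdifferentiableAt (by simp))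
      (complexStructure x v)
  have h2 := kahlerMetric_gradient hΩ (potential s) x (complexStructure x v)
  rw [kahlerMetric, hΩ.invariant] at h2
  have h3 : mvfderiv 𝓘(ℝ, E) (potential s) x (complexStructure x v) =
      -(1 / (2 * Real.pi)) * mvfderiv 𝓘(ℝ, E) (fun y => Real.log ‖s y‖) x (complexStructure x v) :=
    h1
  have h4 : imRho cov s x v =
      -mvfderiv 𝓘(ℝ, E) (fun y => Real.log ‖s y‖) x (complexStructure x v) := by
    rw [imRho_eq hL hcov hs hx]; rfl
  rw [h2, h3, h4]
  have := Real.pi_ne_zero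
  field_simp

theorem IsLagrangian.mem_range_iff [FiniteDimensional ℝ F] (hΩ : IsKahlerForm Ω)
    (hι : IsLagrangian (F := F) Ω ι) (p : S) (u : TangentSpace 𝓘(ℝ, E) (ι p)) :
    u ∈ (mfderiv 𝓘(ℝ, F) 𝓘(ℝ, E) ι p).range ↔
      ∀ v : TangentSpace 𝓘(ℝ, F) p, Ω (ι p) ![u, mfderiv 𝓘(ℝ, F) 𝓘(ℝ, E) ι p v] = 0 := by
  have : FiniteDimensional ℝ E := FiniteDimensional.complexToReal E
  let A : F →ₗ[ℝ] E := (show F →L[ℝ] E from mfderiv 𝓘(ℝ, F) 𝓘(ℝ, E) ι p)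
  have hA : Function.Injective A :=
    mfderiv_injective_of_isImmersionAt (hι.embedding.isImmersion.isImmersionAt p)
  have hdim : Module.finrank ℝ E = 2 * Module.finrank ℝ (LinearMap.range A) := by
    rw [LinearMap.finrank_range_of_inj hA, hι.half_dim, finrank_real_of_complex]
  have hiso : ∀ u ∈ LinearMap.range A, ∀ v ∈ LinearMap.range A, Ω.bilin (ι p) u v = 0 := by
    rintro _ ⟨u, rfl⟩ _ ⟨v, rfl⟩
    exact (Ω.bilin_apply (ι p) _ _).trans (hι.isotropic p u v)
  have key := eq_orthogonal_of_isotropic (hΩ.nondegenerate (ι p)) hdim hiso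
  constructor
  · rintro ⟨w, rfl⟩ v
    exact hι.isotropic p w v
  · intro h
    have : (show E from u) ∈ LinearMap.range A := by
      rw [key]
      rintro _ ⟨v, rfl⟩
      exact (Ω.bilin_swap (ι p) (A v) u).trans
        (neg_eq_zero.2 ((Ω.bilin_apply (ι p) _ _).trans (h v)))
    exact this

theorem isSpecialBohrSommerfeld_iff_gradient [FiniteDimensional ℝ F] (hΩ : IsKahlerForm Ω)
    (hL : IsSmoothHermitian E L) (hcov : IsPrequantumConnection Ω cov) {s : Π x : M, L x}
    (hs : IsHolomorphicSection cov s) (hι : IsLagrangian (F := F) Ω ι) :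
    IsSpecialBohrSommerfeld F cov s ι ↔ Disjoint (range ι) (zeroSet s) ∧
      ∀ p, gradient Ω (potential s) (ι p) ∈ (mfderiv 𝓘(ℝ, F) 𝓘(ℝ, E) ι p).range := by
  have hd : Disjoint (range ι) (zeroSet s) ↔ ∀ p, s (ι p) ≠ 0 := by
    rw [disjoint_left, forall_mem_range]; rfl
  have him : ∀ p, s (ι p) ≠ 0 → (gradient Ω (potential s) (ι p) ∈
      (mfderiv 𝓘(ℝ, F) 𝓘(ℝ, E) ι p).range ↔ ∀ v : TangentSpace 𝓘(ℝ, F) p,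
        imRho cov s (ι p) (mfderiv 𝓘(ℝ, F) 𝓘(ℝ, E) ι p v) = 0) := by
    intro p hp
    rw [hι.mem_range_iff hΩ]
    refine forall_congr' fun v => ?_
    rw [imRho_eq_gradient hΩ hL hcov hs hp]
    simp [Real.pi_ne_zero]
  rw [hd]
  constructor
  · intro h
    exact ⟨h.1, fun p => (him p (h.1 p)).2 fun v =>
      imRho_eq_zero_of_isSpecialBohrSommerfeld hcov hs.1 hι.embedding.contMDiff h p v⟩
  · rintro ⟨hne, hg⟩
    exact isSpecialBohrSommerfeld_of_imRho_eq_zero hL hcov hs.1 hι.embedding.contMDiff hne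
      fun p => (him p (hne p)).1 (hg p)

end Lagrangian

/-! ### Regularity of vector fields induced on a submanifold. -/

section TangentField

variable {E : Type*} [NormedAddCommGroup E] [NormedSpace ℝ E]
  {M : Type*} [TopologicalSpace M] [ChartedSpace E M] [IsManifold 𝓘(ℝ, E) ∞ M]
  {F : Type*} [NormedAddCommGroup F] [NormedSpace ℝ F]
  {S : Type*} [TopologicalSpace S] [ChartedSpace F S] [IsManifold 𝓘(ℝ, F) ∞ S] {ι : S → M} {p : S}

theorem contMDiffAt_tangentMap {f : M → S} {z : TangentBundle 𝓘(ℝ, E) M}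
    (hf : ContMDiffAt 𝓘(ℝ, E) 𝓘(ℝ, F) 2 f z.1) :
    ContMDiffAt (𝓘(ℝ, E).prod 𝓘(ℝ, E)) (𝓘(ℝ, F).prod 𝓘(ℝ, F)) 1
      (tangentMap 𝓘(ℝ, E) 𝓘(ℝ, F) f) z := by
  have : IsManifold 𝓘(ℝ, E) 2 M := .of_le (n := ∞) (by norm_cast)
  have : IsManifold 𝓘(ℝ, F) 2 S := .of_le (n := ∞) (by norm_cast)
  obtain ⟨u, hu, hfu⟩ := (contMDiffAt_iff_contMDiffOn_nhds (by norm_cast)).1 hf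
  obtain ⟨w, hwu, hw, hzw⟩ := mem_nhds_iff.1 hu
  have hfw := hfu.mono hwu
  have h1 := hfw.contMDiffOn_tangentMapWithin (m := 1) (by norm_num) hw.uniqueMDiffOn
  have h2 : IsOpen (TotalSpace.proj ⁻¹' w : Set (TangentBundle 𝓘(ℝ, E) M)) :=
    hw.preimage (FiberBundle.continuous_proj E (TangentSpace 𝓘(ℝ, E)))
  have h3 := h1.contMDiffAt (h2.mem_nhds hzw)
  refine h3.congr_of_eventuallyEq ?_
  filter_upwards [h2.mem_nhds hzw] with y hy
  exact (tangentMapWithin_eq_tangentMap (hw.uniqueMDiffWithinAt hy)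
    ((hfw.contMDiffAt (hw.mem_nhds hy)).mdifferentiableAt (by simp))).symm

/-- A vector field on `S` that an immersion relates to a vector field of class `C^1` is itself of
class `C^1`. -/
theorem contMDiffAt_of_mfderiv_eq (hι : Manifold.IsImmersionAt 𝓘(ℝ, F) 𝓘(ℝ, E) ∞ ι p)
    {G : Π x : M, TangentSpace 𝓘(ℝ, E) x} {X : Π q : S, TangentSpace 𝓘(ℝ, F) q}
    (hG : ContMDiffAt 𝓘(ℝ, E) (𝓘(ℝ, E).prod 𝓘(ℝ, E)) 1
      (fun x => (⟨x, G x⟩ : TangentBundle 𝓘(ℝ, E) M)) (ι p))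
    (hX : ∀ q, mfderiv 𝓘(ℝ, F) 𝓘(ℝ, E) ι q (X q) = G (ι q)) :
    ContMDiffAt 𝓘(ℝ, F) (𝓘(ℝ, F).prod 𝓘(ℝ, F)) 1
      (fun q => (⟨q, X q⟩ : TangentBundle 𝓘(ℝ, F) S)) p := by
  have : IsManifold 𝓘(ℝ, E) 1 M := .of_le (n := ∞) (by norm_cast)
  have : IsManifold 𝓘(ℝ, F) 1 S := .of_le (n := ∞) (by norm_cast)
  obtain ⟨r, hr, hl⟩ := exists_leftInverse_of_isImmersionAt hι
  have hι1 : ContMDiffAt 𝓘(ℝ, F) 𝓘(ℝ, E) 1 ι p := hι.contMDiffAt.of_le (by norm_cast)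
  have hr1 : ContMDiffAt 𝓘(ℝ, E) 𝓘(ℝ, F) 1 r (ι p) := hr.of_le (by norm_cast)
  -- With `r` a local left inverse of `ι`, the field is `X = dr ∘ G ∘ ι` near `p`, so it inherits
  -- the regularity of `G`.
  have h1 := (contMDiffAt_tangentMap (z := (⟨ι p, G (ι p)⟩ : TangentBundle 𝓘(ℝ, E) M))
    (hr.of_le (by norm_cast))).comp p (hG.comp p hι1)
  refine h1.congr_of_eventuallyEq ?_
  filter_upwards [hl, hl.eventually_nhds,
    hι1.continuousAt ((contMDiffAt_iff_contMDiffAt_nhds (by simp)).1 hr1),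
    (contMDiffAt_iff_contMDiffAt_nhds (by simp)).1 hι1] with q hq hq1 hq2 hq3
  have h2 := mfderiv_leftInverse (ContMDiffAt.mdifferentiableAt hq2 (by simp))
    (hq3.mdifferentiableAt (by simp)) hq1 (X q)
  rw [hX] at h2
  change (⟨q, X q⟩ : TangentBundle 𝓘(ℝ, F) S) =
    ⟨r (ι q), mfderiv 𝓘(ℝ, E) 𝓘(ℝ, F) r (ι q) (G (ι q))⟩
  have h3 : ∀ q' : S, q' = q → ∀ w : F, w = X q →
      (⟨q, X q⟩ : TangentBundle 𝓘(ℝ, F) S) = ⟨q', w⟩ := by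
    rintro _ rfl _ rfl; rfl
  exact h3 _ hq _ h2

end TangentField

/-! ### Tangency versus invariance under the flow. -/

section Flow

variable {E : Type*} [NormedAddCommGroup E] [NormedSpace ℂ E] [FiniteDimensional ℂ E]
  {M : Type*} [TopologicalSpace M] [ChartedSpace E M] [IsManifold 𝓘(ℂ, E) ω M]
  {F : Type*} [NormedAddCommGroup F] [NormedSpace ℝ F]
  {S : Type*} [TopologicalSpace S] [ChartedSpace F S] [IsManifold 𝓘(ℝ, F) ∞ S] {ι : S → M}
  {G : Π x : M, TangentSpace 𝓘(ℝ, E) x} {U : Set M}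

/-- The times at which the curve lies in `S` form an open set, by local uniqueness of integral
curves, and a relatively closed one, since the compact `S` is closed in the Hausdorff space `M`. The
interval is connected. -/
theorem isPreservedByFlow_of_mem_range [FiniteDimensional ℝ F] [T2Space M] [CompactSpace S]
    (hι : Manifold.IsSmoothEmbedding 𝓘(ℝ, F) 𝓘(ℝ, E) ∞ ι)
    (hG : ∀ x ∈ U, SmoothVectorFieldAt G x)
    (h : ∀ p, G (ι p) ∈ (mfderiv 𝓘(ℝ, F) 𝓘(ℝ, E) ι p).range) :
    IsPreservedByFlow G U (range ι) := by
  have : CompleteSpace F := FiniteDimensional.complete ℝ F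
  have : IsManifold 𝓘(ℝ, E) 1 M := .of_le (n := ∞) (by norm_cast)
  have : IsManifold 𝓘(ℝ, F) 1 S := .of_le (n := ∞) (by norm_cast)
  choose X hX using h
  intro γ a b hγ hU t₀ ht₀ hγt₀ t ht
  have hclosed : IsClosed (range ι) := (isCompact_range hι.contMDiff.continuous).isClosed
  have hcont : ∀ t ∈ Ioo a b, ContinuousAt γ t := fun t ht =>
    ((hγ t ht).hasMFDerivAt (Ioo_mem_nhds ht.1 ht.2)).continuousAt
  let u : Set ℝ := {t | t ∈ Ioo a b ∧ γ t ∈ range ι}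
  have hu : IsOpen u := by
    rw [isOpen_iff_mem_nhds]
    rintro t ⟨ht, p, hp⟩
    have hGp := (hG (γ t) (hU ht)).of_le (n := ∞) (m := 1) (by norm_cast)
    -- The field `G` lifts to `X` on `S`. An integral curve of `X` in `S` is mapped by `ι` to one of
    -- `G` through the same point, so it agrees with `γ` near `t`.
    obtain ⟨β, hβt, hβ⟩ := exists_isMIntegralCurveAt_of_contMDiffAt_boundaryless t
      (contMDiffAt_of_mfderiv_eq (hι.isImmersion.isImmersionAt p) (hp ▸ hGp) hX)
    have hιβ : IsMIntegralCurveAt (ι ∘ β) G t := by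
      refine Filter.Eventually.mono hβ fun t' ht' => ?_
      have h1 := (hι.contMDiff.mdifferentiable (by simp) (β t')).hasMFDerivAt.comp t' ht'
      refine h1.congr_mfderiv ?_
      have h2 : mfderiv 𝓘(ℝ, F) 𝓘(ℝ, E) ι (β t') ((1 : ℝ) • X (β t')) =
          (1 : ℝ) • G (ι (β t')) := by
        rw [map_smul]
        exact congrArg (fun w : E => (1 : ℝ) • w) (hX (β t'))
      exact ContinuousLinearMap.ext_ring h2
    have heq := isMIntegralCurveAt_eventuallyEq_of_contMDiffAt_boundaryless hGp
      (hγ.isMIntegralCurveAt (Ioo_mem_nhds ht.1 ht.2)) hιβ (by simp [hβt, hp])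
    filter_upwards [heq, Ioo_mem_nhds ht.1 ht.2] with t' h1 h2
    exact ⟨h2, h1 ▸ mem_range_self _⟩
  refine (isPreconnected_Ioo.subset_of_closure_inter_subset hu ⟨t₀, ht₀, ht₀, hγt₀⟩ ?_ ht).2
  rintro t ⟨htu, ht⟩
  exact ⟨ht, hclosed.mem_of_frequently_of_tendsto
    ((mem_closure_iff_frequently.1 htu).mono fun _ h => h.2) (hcont t ht)⟩

/-- The integral curve through `ι p` stays in `S`, so its velocity `G (ι p)` is tangent to `S`.
Compactness plays no role in this direction. -/
theorem IsPreservedByFlow.mem_range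
    (hι : Manifold.IsSmoothEmbedding 𝓘(ℝ, F) 𝓘(ℝ, E) ∞ ι) (hU : IsOpen U)
    (hιU : range ι ⊆ U) (hG : ∀ x ∈ U, SmoothVectorFieldAt G x)
    (h : IsPreservedByFlow G U (range ι)) (p : S) :
    G (ι p) ∈ (mfderiv 𝓘(ℝ, F) 𝓘(ℝ, E) ι p).range := by
  have : FiniteDimensional ℝ E := FiniteDimensional.complexToReal E
  have : CompleteSpace E := FiniteDimensional.complete ℝ E
  have : IsManifold 𝓘(ℝ, E) 1 M := .of_le (n := ∞) (by norm_cast)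
  have hpU := hιU (mem_range_self p)
  have hGp := (hG (ι p) hpU).of_le (n := ∞) (m := 1) (by norm_cast)
  obtain ⟨γ, hγ0, hγ⟩ := exists_isMIntegralCurveAt_of_contMDiffAt_boundaryless (0 : ℝ) hGp
  have hγc : Filter.Tendsto γ (𝓝 0) (𝓝 (ι p)) := hγ0 ▸ hγ.continuousAt
  obtain ⟨δ, hδ, hball⟩ := Metric.eventually_nhds_iff_ball.1
    (Filter.Eventually.and hγ (hγc (hU.mem_nhds hpU)))
  rw [Real.ball_eq_Ioo] at hball
  have h0 : (0 : ℝ) ∈ Ioo (0 - δ) (0 + δ) := ⟨by linarith, by linarith⟩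
  have hmem := h γ _ _ (fun t ht => (hball t ht).1.hasMFDerivWithinAt)
    (fun t ht => (hball t ht).2) 0 h0 ⟨p, hγ0.symm⟩
  obtain ⟨r, hr, hl⟩ := exists_leftInverse_of_isImmersionAt (hι.isImmersion.isImmersionAt p)
  -- The identity `r ∘ ι = id` is known near `p` in `S`, but `γ` is only known to approach `ι p` in
  -- `M`. The embedding turns one kind of nearness into the other.
  rw [hι.isEmbedding.nhds_eq_comap, Filter.eventually_comap] at hl
  -- Factoring `γ` through `S` by a differentiable map exhibits its velocity as a value of `dι`.
  have hev : γ =ᶠ[𝓝 0] ι ∘ r ∘ γ := by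
    filter_upwards [hγc.eventually hl, Ioo_mem_nhds h0.1 h0.2] with t ht ht'
    obtain ⟨q, hq⟩ := hmem t ht'
    change γ t = ι (r (γ t))
    rw [← hq, ht q hq]
  have hrp : r (ι p) = p := hl.self_of_nhds p rfl
  have hr0 : MDifferentiableAt 𝓘(ℝ, E) 𝓘(ℝ, F) r (γ 0) := by
    rw [hγ0]; exact hr.mdifferentiableAt (by simp)
  have h1 := (hι.contMDiff.mdifferentiable (by simp) (r (γ 0))).hasMFDerivAt.comp (0 : ℝ)
    (hr0.hasMFDerivAt.comp (0 : ℝ) hγ.hasMFDerivAt)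
  have h2 := hasMFDerivAt_unique hγ.hasMFDerivAt (h1.congr_of_eventuallyEq hev)
  have h3 : (1 : ℝ) • (show E from G (γ 0)) = mfderiv 𝓘(ℝ, F) 𝓘(ℝ, E) ι (r (γ 0))
      (mfderiv 𝓘(ℝ, E) 𝓘(ℝ, F) r (γ 0) ((1 : ℝ) • G (γ 0))) :=
    congrArg (fun A : ℝ →L[ℝ] E => A 1) h2
  have h4 : ∀ x : M, x = ι p → ∀ q : S, q = p → ∀ w : F, (show E from G x) =
      (show F →L[ℝ] E from mfderiv 𝓘(ℝ, F) 𝓘(ℝ, E) ι q) w →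
      G (ι p) ∈ (mfderiv 𝓘(ℝ, F) 𝓘(ℝ, E) ι p).range := by
    rintro _ rfl _ rfl w hw
    exact ⟨w, hw.symm⟩
  rw [one_smul] at h3
  exact h4 _ hγ0 (r (γ 0)) (by rw [hγ0, hrp]) _ h3

end Flow

/-! ### Smoothness of the gradient. -/

section Gradient

theorem contDiffAt_inverse_curryTwoForm {E : Type*} [NormedAddCommGroup E] [NormedSpace ℝ E]
    [CompleteSpace E] {α : E → E [⋀^Fin 2]→L[ℝ] ℝ} {l : E → E →L[ℝ] ℝ} {y : E} (J : E →L[ℝ] E)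
    (hα : ContDiffAt ℝ ∞ α y) (hl : ContDiffAt ℝ ∞ l y)
    (h : ((curryTwoForm E (α y)).comp J).IsInvertible) :
    ContDiffAt ℝ ∞ (fun z => ((curryTwoForm E (α z)).comp J).inverse (l z)) y := by
  have h0 : ContDiff ℝ ∞ (fun a : E [⋀^Fin 2]→L[ℝ] ℝ => curryTwoForm E a) :=
    ContinuousLinearMap.contDiff _
  have h1 : ContDiffAt ℝ ∞ (fun z => curryTwoForm E (α z)) y := h0.contDiffAt.comp y hα
  have h2 : ContDiffAt ℝ ∞ (fun z => (curryTwoForm E (α z)).comp J) y :=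
    h1.clm_comp contDiffAt_const
  obtain ⟨A, hA⟩ := h
  have h3 := contDiffAt_map_inverse (n := ∞) A
  rw [hA] at h3
  exact (h3.comp y h2).clm_apply hl

theorem isInvertible_of_injective {E : Type*} [NormedAddCommGroup E] [NormedSpace ℝ E]
    [FiniteDimensional ℝ E] {B : E →L[ℝ] E →L[ℝ] ℝ} (hB : Function.Injective B) :
    B.IsInvertible := by
  have hdim : Module.finrank ℝ E = Module.finrank ℝ (E →L[ℝ] ℝ) := by
    rw [← (LinearMap.toContinuousLinearMap (𝕜 := ℝ) (E := E) (F' := ℝ)).finrank_eq]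
    exact (Subspace.dual_finrank_eq).symm
  refine ⟨(LinearEquiv.ofInjectiveOfFinrankEq (B : E →ₗ[ℝ] E →L[ℝ] ℝ) hB
    hdim).toContinuousLinearEquiv, ?_⟩
  ext; rfl

theorem apply_inverse_of_isInvertible {E F : Type*} [NormedAddCommGroup E] [NormedSpace ℝ E]
    [NormedAddCommGroup F] [NormedSpace ℝ F] {B : E →L[ℝ] F} (hB : B.IsInvertible) (l : F) :
    B (B.inverse l) = l := by
  obtain ⟨A, rfl⟩ := hB
  rw [ContinuousLinearMap.inverse_equiv]
  exact A.apply_symm_apply l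

variable {E : Type*} [NormedAddCommGroup E] [NormedSpace ℂ E] [FiniteDimensional ℂ E]
  {M : Type*} [TopologicalSpace M] [ChartedSpace E M] [IsManifold 𝓘(ℂ, E) ω M]
  {Ω : Form E M 2}

/-- The gradient is chosen pointwise, so smoothness is not visible in its definition. In a chart it
must be `B⁻¹(dφ)`, with `B` the metric as a map to the dual; inversion of operators is smooth, and
`eq_gradient` identifies the two fields. -/
theorem smoothVectorFieldAt_gradient (hΩ : IsKahlerForm Ω) {f : M → ℝ} {U : Set M}
    (hU : IsOpen U) (hf : ContMDiffOn 𝓘(ℝ, E) 𝓘(ℝ) ∞ f U) {x : M} (hx : x ∈ U) :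
    SmoothVectorFieldAt (gradient Ω f) x := by
  have : FiniteDimensional ℝ E := FiniteDimensional.complexToReal E
  have : CompleteSpace E := FiniteDimensional.complete ℝ E
  let e := chartAt E x
  have he : e ∈ IsManifold.maximalAtlas 𝓘(ℂ, E) ω M := chartAt_mem_maximalAtlas x
  have hxe : x ∈ e.source := mem_chart_source E x
  let J : E →L[ℝ] E := Complex.I • ContinuousLinearMap.id ℝ E
  let B : E → E →L[ℝ] E →L[ℝ] ℝ := fun y => (curryTwoForm E (Ω.inChart x y)).comp J
  have hB : ∀ y ∈ e.source, ∀ u v : E, B (e y) u v =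
      kahlerMetric Ω y (chartField e u y) (chartField e v y) := by
    intro y hy u v
    have h1 : B (e y) u v = Ω (e.symm (e y)) ![
        mfderiv 𝓘(ℝ, E) 𝓘(ℝ, E) e.symm (e y) (Complex.I • u),
        mfderiv 𝓘(ℝ, E) 𝓘(ℝ, E) e.symm (e y) v] := by
      refine (curryTwoForm_apply _ _ _).trans ?_
      refine congrArg (Ω (e.symm (e y))) ?_
      ext i; fin_cases i <;> rfl
    rw [h1, mfderiv_chart_symm he (e.map_source hy), mfderiv_chart_symm he (e.map_source hy),
      e.left_inv hy, chartField_I_smul he hy, kahlerMetric]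
  have hBinv : ∀ y ∈ e.source, (B (e y)).IsInvertible := by
    refine fun y hy => isInvertible_of_injective ((injective_iff_map_eq_zero _).2 fun u hu => ?_)
    by_contra hne
    have h1 := hΩ.pos y _ (chartField_ne_zero he hy hne)
    have h3 : B (e y) u u = 0 := congrArg (fun A : E →L[ℝ] ℝ => A u) hu
    exact h1.ne' ((hB y hy u u).symm.trans h3)
  let φ : E → ℝ := f ∘ e.symm
  let g : E → E := fun y => (B y).inverse (fderiv ℝ φ y)
  have hg : ContDiffAt ℝ ∞ g (e x) := by
    have h1 : ContDiffAt ℝ ∞ (Ω.inChart x) (e x) :=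
      (hΩ.smooth x).contDiffAt ((isOpen_extChartAt_target x).mem_nhds (mem_extChartAt_target x))
    have h2 : ContDiffAt ℝ ∞ φ (e x) :=
      contDiffAt_comp_chart_symm he hxe (hf.contMDiffAt (hU.mem_nhds hx))
    exact contDiffAt_inverse_curryTwoForm J h1 (h2.fderiv_right (m := ∞) (by norm_cast))
      (hBinv x hxe)
  refine (smoothVectorFieldAt_pullbackField he hxe hg).congr_of_eventuallyEq ?_
  filter_upwards [e.open_source.mem_nhds hxe, hU.mem_nhds hx] with y hy hyU
  refine congrArg (TotalSpace.mk' E y) (eq_gradient hΩ fun v => ?_)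
  have h1 : pullbackField e g y = chartField e (g (e y)) y := by
    conv_lhs => rw [eq_chartField he hy (pullbackField e g y), mvfderiv_pullbackField he hy]
  have h2 : B (e y) (g (e y)) = fderiv ℝ φ (e y) := apply_inverse_of_isInvertible (hBinv y hy) _
  rw [h1, eq_chartField he hy v, ← hB y hy, h2,
    mvfderiv_eq_fderiv_chart he hy (hf.contMDiffAt (hU.mem_nhds hyU)),
    mvfderiv_pullbackField he hy]

end Gradient

end SBS

end

theorem proposition7
    {E : Type*} [NormedAddCommGroup E] [NormedSpace ℂ E] [FiniteDimensional ℂ E]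
    {M : Type*} [TopologicalSpace M] [T2Space M] [ChartedSpace E M] [IsManifold 𝓘(ℂ, E) ω M]
    (Ω : SBS.Form E M 2) (hΩ : SBS.IsKahlerForm Ω)
    (L : M → Type*) [∀ x, NormedAddCommGroup (L x)] [∀ x, InnerProductSpace ℂ (L x)]
    [TopologicalSpace (TotalSpace ℂ L)] [FiberBundle ℂ L] [VectorBundle ℂ ℂ L]
    [ContMDiffVectorBundle ∞ ℂ L 𝓘(ℝ, E)] (hL : SBS.IsSmoothHermitian E L)
    (cov : CovariantDerivative 𝓘(ℝ, E) ℂ L) (hcov : SBS.IsPrequantumConnection Ω cov)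
    (s : Π x : M, L x) (hs : SBS.IsHolomorphicSection cov s) :
    -- the calibrating form is `-I d ln |s|` off the zero set
    (∀ x ∉ SBS.zeroSet s, SBS.imRho cov s x =
      -SBS.complexStructureForm (mvfderiv 𝓘(ℝ, E) (fun y => Real.log ‖s y‖)) x) ∧
    -- the potential is smooth off the zero set, `d (I dφ) = Ω`, and it is strictly plurisubharmonic
    (IsOpen (SBS.zeroSet s)ᶜ ∧
      ContMDiffOn 𝓘(ℝ, E) 𝓘(ℝ) ∞ (SBS.potential s) (SBS.zeroSet s)ᶜ ∧
      (∀ x ∉ SBS.zeroSet s, (SBS.oneForm (SBS.complexStructureForm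
        (mvfderiv 𝓘(ℝ, E) (SBS.potential s)))).d x = Ω x) ∧
      SBS.IsStrictlyPlurisubharmonicOn E (SBS.potential s) (SBS.zeroSet s)ᶜ) ∧
    ∀ (F : Type*) [NormedAddCommGroup F] [NormedSpace ℝ F] [FiniteDimensional ℝ F]
      (S : Type*) [TopologicalSpace S] [ChartedSpace F S] [IsManifold 𝓘(ℝ, F) ∞ S]
      (ι : S → M), SBS.IsLagrangian (F := F) Ω ι →
      -- special Bohr–Sommerfeld iff the gradient is tangent to `S` at each point
      (SBS.IsSpecialBohrSommerfeld F cov s ι ↔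
        Disjoint (range ι) (SBS.zeroSet s) ∧
          ∀ p, SBS.gradient Ω (SBS.potential s) (ι p) ∈
            (mfderiv 𝓘(ℝ, F) 𝓘(ℝ, E) ι p).range) ∧
      -- equivalently, for compact `S`, iff `S` is preserved by the gradient flow
      (CompactSpace S → (SBS.IsSpecialBohrSommerfeld F cov s ι ↔
        Disjoint (range ι) (SBS.zeroSet s) ∧
          SBS.IsPreservedByFlow (SBS.gradient Ω (SBS.potential s)) (SBS.zeroSet s)ᶜ (range ι))) := by
  have hO := SBS.isOpen_compl_zeroSet hs.1
  have hφ := SBS.contMDiffOn_potential hL hs.1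
  refine ⟨fun x hx => SBS.imRho_eq hL hcov hs hx,
    ⟨hO, hφ, fun x hx => SBS.d_complexStructureForm_potential hL hcov hs hx,
      SBS.isStrictlyPlurisubharmonicOn_potential hΩ hL hcov hs⟩, ?_⟩
  intro F _ _ _ S _ _ _ ι hι
  have key := SBS.isSpecialBohrSommerfeld_iff_gradient hΩ hL hcov hs hι
  -- Both criteria contain disjointness from `D_s`; given that, only tangency versus invariance
  -- under the flow remains.
  refine ⟨key, fun _ => key.trans (and_congr_right fun hd => ?_)⟩
  have hG : ∀ x ∈ (SBS.zeroSet s)ᶜ,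
      SBS.SmoothVectorFieldAt (SBS.gradient Ω (SBS.potential s)) x :=
    fun x hx => SBS.smoothVectorFieldAt_gradient hΩ hO hφ hx
  exact ⟨SBS.isPreservedByFlow_of_mem_range hι.embedding hG,
    SBS.IsPreservedByFlow.mem_range hι.embedding hO (Set.subset_compl_iff_disjoint_right.2 hd) hG⟩
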